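/- **Setting.** Let $(\widetilde M,P,\pi)$ be a deformation of complex manifolds: $P$ is a $C^\infty$ manifold of real dimension $s$, $\widetilde M$ is a $C^\infty$ manifold of real dimension $2n+s$ (manifolds are Hausdorff and second countable), and $\pi:\widetilde M\to P$ is a surjective $C^\infty$ map for which $\widetilde M$ is covered by adapted charts. An adapted chart maps an open set $U_\alpha$ diffeomorphically onto a product $D\times V$ of open sets $D\subset\mathbb C^n$, $V\subset\mathbb R^s$, with coordinates $(z^\alpha,t^\alpha)$, where $t^\alpha$ is the composition of $\pi$ with a diffeomorphism $\pi(U_\alpha)\to V$, and the coordinate changes $z^\alpha\mapsto z^\beta(z^\alpha,t^\alpha)$ are holomorphic for each fixed $t^\alpha$. Let $M_t=\pi^{-1}(t)$ and let $\iota_t:M_t\hookrightarrow\widetilde M$ be the embedding. Let $\widetilde{\mathcal O}$ be the sheaf of $C^\infty$ functions on $\widetilde M$ that are holomorphic along the fibres of $\pi$, let $T\pi$ be the bundle of $(1,0)$-vectors tangent to the fibres, with local frames $\partial/\partial z^\alpha_1,\dots,\partial/\partial z^\alpha_n$, and let $\widetilde{\mathcal O}(T\pi)$ be the sheaf of its sections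 whose components in these frames lie in $\widetilde{\mathcal O}$. A deformation of foliations on $\widetilde M$ is an $\widetilde{\mathcal O}$-submodule $\widetilde{\mathcal F}\subset\widetilde{\mathcal O}(T\pi)$ that is coherent (locally there are exact sequences $\widetilde{\mathcal O}^k\to\widetilde{\mathcal O}^q\to\widetilde{\mathcal F}\to0$) and satisfies $[\widetilde{\mathcal F},\widetilde{\mathcal F}]\subset\widetilde{\mathcal F}$. Put $\mathcal N_{\widetilde{\mathcal F}}=\widetilde{\mathcal O}(T\pi)/\widetilde{\mathcal F}$, and let $S(\widetilde{\mathcal F})$ be the set of points $x\in\widetilde M$ at which the stalk $\mathcal N_{\widetilde{\mathcal F},x}$ is not a free $\widetilde{\mathcal O}_x$-module. **Statement.** Let $\widetilde{\mathcal F}$ be a deformation of foliations on $\widetilde M$ with $S(\widetilde{\mathcal F})=\emptyset$, of rank $p$ (the stalks of $\widetilde{\mathcal F}$, which are then free, have rank $p$). The normal bundle $\mathcal N_{\widetilde{\mathcal F}}$ is then the $C^\infty$ complex vector bundle whose fibre at $x$ is the quotient of $T_x\pi$ by the values at $x$ of local sections of $\widetilde{\mathcal F}$, and whose $C^\infty$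 sections are locally the classes of $C^\infty$ sections of $T\pi$. There is a $C^\infty$ connection $\nabla$ on $\mathcal N_{\widetilde{\mathcal F}}$ such that $$\iota_t^*\bigl(\varphi(\nabla)\bigr)=0$$ for all $t\in P$ and all symmetric homogeneous polynomials $\varphi$ with complex coefficients of degree $d>n-p$. Here, if $K$ is the curvature of $\nabla$ and $\varphi\in\mathbb C[x_1,\dots,x_m]$ (any $m$) is written as $\varphi=\varphi'(e_1,\dots,e_m)$ in the elementary symmetric polynomials, then $\varphi(\nabla)=\bigl(\tfrac{\sqrt{-1}}{2\pi}\bigr)^d\varphi'(\sigma_1(K),\dots,\sigma_m(K))$, a $2d$-form on $\widetilde M$, where $\det(1+\tau K)=\sum_k\sigma_k(K)\tau^k$. -/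

import Mathlib

open scoped Manifold ContDiff Topology
open TopologicalSpace Filter

noncomputable section

namespace RelFol

/-! ### Deformations of complex manifolds -/

/-- The coordinate space `ℂⁿ × ℝˢ` (real dimension `2n + s`) of the ambient manifold; its points are
the adapted coordinates `(z, t)`. -/
abbrev Model (n s : ℕ) : Type := (Fin n → ℂ) × (Fin s → ℝ)

/-- The (boundaryless) model of the `C^∞` manifold `M`. -/
abbrev IM (n s : ℕ) := 𝓘(ℝ, Model n s)

/-- The (boundaryless) model of the `C^∞` parameter manifold `P`. -/
abbrev IP (s : ℕ) := 𝓘(ℝ, Fin s → ℝ)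

/-- The triple `(M, P, π)` is a deformation of complex manifolds of dimension `n`: `M` and `P` are
`C^∞` manifolds of real dimensions `2n + s` and `s`, `π` is a smooth surjection, and the charts of
the given atlas of `M` form an adapted covering, i.e.

* each chart `e` maps its domain onto a product `D × V` of open sets of `ℂⁿ` and `ℝˢ`, and its
  second component is `h ∘ π` for a smooth chart `h` of `P` from the image of the domain onto `V`;
* the change of charts is holomorphic in `z` for each fixed value of `t`. -/
structure IsDeformation (n s : ℕ) {M P : Type*}
    [TopologicalSpace M] [ChartedSpace (Model n s) M] [IsManifold (IM n s) ∞ M]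
    [TopologicalSpace P] [ChartedSpace (Fin s → ℝ) P] [IsManifold (IP s) ∞ P]
    (π : M → P) : Prop where
  smooth : ContMDiff (IM n s) (IP s) ∞ π
  surjective : Function.Surjective π
  adapted : ∀ e ∈ atlas (Model n s) M, ∃ (D : Set (Fin n → ℂ)) (V : Set (Fin s → ℝ)),
    IsOpen D ∧ IsOpen V ∧ e.target = D ×ˢ V ∧
      ∃ h ∈ IsManifold.maximalAtlas (IP s) ∞ P,
        h.source = π '' e.source ∧ h.target = V ∧ ∀ x ∈ e.source, (e x).2 = h (π x)
  holomorphic : ∀ e ∈ atlas (Model n s) M, ∀ e' ∈ atlas (Model n s) M, ∀ t : Fin s → ℝ,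
    DifferentiableOn ℂ (fun z => (e' (e.symm (z, t))).1)
      {z | (z, t) ∈ e.target ∧ e.symm (z, t) ∈ e'.source}

section Sheaves

variable (n s : ℕ) {M : Type*} [TopologicalSpace M] [ChartedSpace (Model n s) M]

/-! Sections over a subset `U` of `M` are represented by functions on `M`, of which only the values
on `U` matter. -/

/-- `f ∈ Õ(U)`: the function `f` is `C^∞` on `U` and holomorphic along the fibres, i.e. in each
adapted chart `f(z, t)` is holomorphic in `z` for each fixed `t`. -/
structure IsRelHol (U : Set M) (f : M → ℂ) : Prop where
  smooth : ContMDiffOn (IM n s) 𝓘(ℝ, ℂ) ∞ f U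
  holomorphic : ∀ e ∈ atlas (Model n s) M, ∀ t : Fin s → ℝ,
    DifferentiableOn ℂ (fun z => f (e.symm (z, t))) {z | (z, t) ∈ e.target ∧ e.symm (z, t) ∈ U}

/-- The fibre at `x` of the bundle `Tπ` of vectors of type `(1,0)` tangent to the fibres of `π`:
the vector `∑ vⱼ ∂/∂zⱼ` is represented by `v ∈ ℂⁿ`, where `z` are the coordinates of the preferred
adapted chart `chartAt _ x` at `x`. -/
abbrev RelTangent (n : ℕ) : Type := Fin n → ℂ

/-- The components, with respect to the frame `∂/∂z₁, …, ∂/∂zₙ` of the adapted chart `e`, of a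
vector of `Tπ` at the point `x`: this is the (complex) Jacobian matrix at `x` of the change from
the `z`-coordinates of the preferred chart at `x` to those of `e`. -/
def relJacobian (e : OpenPartialHomeomorph M (Model n s)) (x : M) :
    RelTangent n →L[ℂ] (Fin n → ℂ) :=
  fderiv ℂ (fun z => (e ((chartAt (Model n s) x).symm (z, (chartAt (Model n s) x x).2))).1)
    (chartAt (Model n s) x x).1

/-- The components of a section `X` of `Tπ` with respect to the frame `∂/∂zⱼ` of the chart `e`. -/
def components (e : OpenPartialHomeomorph M (Model n s)) (X : M → RelTangent n) (x : M) :
    Fin n → ℂ :=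
  relJacobian n s e x (X x)

/-- `X` is a `C^∞` section of `Tπ` over `U`: its components with respect to the frame of any adapted
chart are `C^∞`. -/
def IsSmoothRelField (U : Set M) (X : M → RelTangent n) : Prop :=
  ∀ e ∈ atlas (Model n s) M, ∀ i,
    ContMDiffOn (IM n s) 𝓘(ℝ, ℂ) ∞ (fun x => components n s e X x i) (U ∩ e.source)

/-- `X ∈ Õ(Tπ)(U)`: the components of `X` with respect to the frame of any adapted chart belong
to `Õ`. -/
def IsRelHolField (U : Set M) (X : M → RelTangent n) : Prop :=
  ∀ e ∈ atlas (Model n s) M, ∀ i,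
    IsRelHol n s (U ∩ e.source) (fun x => components n s e X x i)

/-- The Lie bracket `[X, Y] = ∑ (Xⱼ ∂Yₖ/∂zⱼ - Yⱼ ∂Xₖ/∂zⱼ) ∂/∂zₖ` of sections of `Õ(Tπ)`. Its value
at `x` is computed in the preferred chart at `x`; `VectorField.lieBracket ℂ` is the bracket of
vector fields on `ℂⁿ`, here on the slice `t = const`. -/
def relBracket (X Y : M → RelTangent n) (x : M) : RelTangent n :=
  let c := chartAt (Model n s) x
  VectorField.lieBracket ℂ
    (fun z => components n s c X (c.symm (z, (c x).2)))
    (fun z => components n s c Y (c.symm (z, (c x).2))) (c x).1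

variable {n s}

theorem IsRelHol.mono {U V : Set M} {f : M → ℂ} (h : IsRelHol n s U f) (hV : V ⊆ U) :
    IsRelHol n s V f :=
  ⟨h.smooth.mono hV, fun e he t => (h.holomorphic e he t).mono fun _ hz => ⟨hz.1, hV hz.2⟩⟩

theorem IsRelHol.const (U : Set M) (c : ℂ) : IsRelHol n s U (fun _ => c) :=
  ⟨contMDiffOn_const, fun _ _ _ => differentiableOn_const c⟩

theorem IsRelHol.add {U : Set M} {f g : M → ℂ} (hf : IsRelHol n s U f) (hg : IsRelHol n s U g) :
    IsRelHol n s U (f + g) :=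
  ⟨hf.smooth.add hg.smooth, fun e he t => (hf.holomorphic e he t).add (hg.holomorphic e he t)⟩

theorem IsRelHol.neg {U : Set M} {f : M → ℂ} (hf : IsRelHol n s U f) : IsRelHol n s U (-f) :=
  ⟨hf.smooth.neg, fun e he t => (hf.holomorphic e he t).neg⟩

theorem IsRelHol.mul {U : Set M} {f g : M → ℂ} (hf : IsRelHol n s U f) (hg : IsRelHol n s U g) :
    IsRelHol n s U (f * g) :=
  ⟨by
    have h : ContMDiff (𝓘(ℝ, ℂ).prod 𝓘(ℝ, ℂ)) 𝓘(ℝ, ℂ) ∞ (fun p : ℂ × ℂ => p.1 * p.2) := by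
      rw [← modelWithCornersSelf_prod, chartedSpaceSelf_prod]
      exact (contDiff_fst.mul contDiff_snd).contMDiff
    exact h.comp_contMDiffOn (hf.smooth.prodMk hg.smooth),
   fun e he t => (hf.holomorphic e he t).mul (hg.holomorphic e he t)⟩

theorem IsRelHolField.mono {U V : Set M} {X : M → RelTangent n} (h : IsRelHolField n s U X)
    (hV : V ⊆ U) : IsRelHolField n s V X :=
  fun e he i => (h e he i).mono (Set.inter_subset_inter_left _ hV)

theorem IsRelHolField.zero (U : Set M) : IsRelHolField n s U (0 : M → RelTangent n) := by
  intro e _ i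
  simpa [components] using IsRelHol.const (n := n) (s := s) (U ∩ e.source) 0

theorem IsRelHolField.add {U : Set M} {X Y : M → RelTangent n} (hX : IsRelHolField n s U X)
    (hY : IsRelHolField n s U Y) : IsRelHolField n s U (X + Y) := by
  intro e he i
  convert (hX e he i).add (hY e he i) using 1
  ext x
  simp [components]

theorem IsRelHolField.smul {U : Set M} {f : M → ℂ} {X : M → RelTangent n}
    (hf : IsRelHol n s U f) (hX : IsRelHolField n s U X) :
    IsRelHolField n s U (fun x => f x • X x) := by
  intro e he i
  convert (hf.mono (Set.inter_subset_left (t := e.source))).mul (hX e he i) using 1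
  ext x
  simp [components]

variable (n s)

/-! ### Stalks -/

/-- The stalk `Õ_x`, a ring of germs of functions at `x`. -/
def stalkRing (x : M) : Subring (Germ (𝓝 x) ℂ) where
  carrier := {g | ∃ (U : Opens M) (f : M → ℂ), x ∈ U ∧ IsRelHol n s (U : Set M) f ∧ g = ↑f}
  mul_mem' := by
    rintro _ _ ⟨U, f, hU, hf, rfl⟩ ⟨V, g, hV, hg, rfl⟩
    exact ⟨U ⊓ V, f * g, ⟨hU, hV⟩,
      (hf.mono fun _ h => h.1).mul (hg.mono fun _ h => h.2), rfl⟩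
  add_mem' := by
    rintro _ _ ⟨U, f, hU, hf, rfl⟩ ⟨V, g, hV, hg, rfl⟩
    exact ⟨U ⊓ V, f + g, ⟨hU, hV⟩,
      (hf.mono fun _ h => h.1).add (hg.mono fun _ h => h.2), rfl⟩
  one_mem' := ⟨⊤, fun _ => 1, trivial, IsRelHol.const _ 1, rfl⟩
  zero_mem' := ⟨⊤, fun _ => 0, trivial, IsRelHol.const _ 0, rfl⟩
  neg_mem' := by
    rintro _ ⟨U, f, hU, hf, rfl⟩
    exact ⟨U, -f, hU, hf.neg, rfl⟩

/-- The stalk `Õ(Tπ)_x`, an `Õ_x`-module of germs of vector fields at `x`. -/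
def tangentStalk (x : M) : Submodule (stalkRing n s x) (Germ (𝓝 x) (RelTangent n)) where
  carrier := {g | ∃ (U : Opens M) (X : M → RelTangent n),
    x ∈ U ∧ IsRelHolField n s (U : Set M) X ∧ g = ↑X}
  zero_mem' := ⟨⊤, 0, trivial, IsRelHolField.zero _, rfl⟩
  add_mem' := by
    rintro _ _ ⟨U, X, hU, hX, rfl⟩ ⟨V, Y, hV, hY, rfl⟩
    exact ⟨U ⊓ V, X + Y, ⟨hU, hV⟩,
      (hX.mono fun _ h => h.1).add (hY.mono fun _ h => h.2), rfl⟩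
  smul_mem' := by
    rintro ⟨_, V, f, hV, hf, rfl⟩ _ ⟨U, X, hU, hX, rfl⟩
    exact ⟨V ⊓ U, fun x => f x • X x, ⟨hV, hU⟩,
      IsRelHolField.smul (hf.mono fun _ h => h.1) (hX.mono fun _ h => h.2), rfl⟩

end Sheaves

/-! ### Deformations of foliations -/

/-- An `Õ`-submodule (subsheaf of modules) of `Õ(Tπ)`; `IsSec U X` says that `X` restricted to `U`
is a section over `U`. -/
structure SubmoduleSheaf (n s : ℕ) (M : Type*)
    [TopologicalSpace M] [ChartedSpace (Model n s) M] where
  IsSec : Opens M → (M → RelTangent n) → Prop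
  congr : ∀ {U : Opens M} {X Y : M → RelTangent n}, Set.EqOn X Y U → IsSec U X → IsSec U Y
  isRelHolField : ∀ {U : Opens M} {X : M → RelTangent n},
    IsSec U X → IsRelHolField n s (U : Set M) X
  zero : ∀ U : Opens M, IsSec U 0
  add : ∀ {U : Opens M} {X Y : M → RelTangent n}, IsSec U X → IsSec U Y → IsSec U (X + Y)
  smul : ∀ {U : Opens M} {f : M → ℂ} {X : M → RelTangent n},
    IsRelHol n s (U : Set M) f → IsSec U X → IsSec U (fun x => f x • X x)
  restrict : ∀ {U V : Opens M} {X : M → RelTangent n}, V ≤ U → IsSec U X → IsSec V X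
  glue : ∀ {U : Opens M} {X : M → RelTangent n},
    (∀ x ∈ U, ∃ V : Opens M, x ∈ V ∧ IsSec V X) → IsSec U X

namespace SubmoduleSheaf

variable {n s : ℕ} {M : Type*} [TopologicalSpace M] [ChartedSpace (Model n s) M]

/-- Coherence: near each point there is an exact sequence `Õ^k → Õ^q → F → 0` of sheaves. The map
`Õ^q → F` is given by the sections `G i`, the map `Õ^k → Õ^q` by the vectors `R j`; exactness of a
sequence of sheaves means local surjectivity onto `F` and onto the kernel. -/
def IsCoherent (F : SubmoduleSheaf n s M) : Prop :=
  ∀ x : M, ∃ U : Opens M, x ∈ U ∧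
    ∃ (q k : ℕ) (G : Fin q → M → RelTangent n) (R : Fin k → Fin q → M → ℂ),
      (∀ i, F.IsSec U (G i)) ∧
      (∀ j i, IsRelHol n s (U : Set M) (R j i)) ∧
      (∀ j, ∀ y ∈ U, ∑ i, R j i y • G i y = 0) ∧
      (∀ V : Opens M, V ≤ U → ∀ X, F.IsSec V X → ∀ y ∈ V, ∃ W : Opens M, y ∈ W ∧ W ≤ V ∧
        ∃ f : Fin q → M → ℂ, (∀ i, IsRelHol n s (W : Set M) (f i)) ∧
          ∀ w ∈ W, X w = ∑ i, f i w • G i w) ∧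
      (∀ V : Opens M, V ≤ U → ∀ f : Fin q → M → ℂ, (∀ i, IsRelHol n s (V : Set M) (f i)) →
        (∀ y ∈ V, ∑ i, f i y • G i y = 0) → ∀ y ∈ V, ∃ W : Opens M, y ∈ W ∧ W ≤ V ∧
          ∃ g : Fin k → M → ℂ, (∀ j, IsRelHol n s (W : Set M) (g j)) ∧
            ∀ w ∈ W, ∀ i, f i w = ∑ j, g j w * R j i w)

/-- `[F, F] ⊆ F`. -/
def IsInvolutive (F : SubmoduleSheaf n s M) : Prop :=
  ∀ (U : Opens M) (X Y : M → RelTangent n),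
    F.IsSec U X → F.IsSec U Y → F.IsSec U (relBracket n s X Y)

/-- A deformation of foliations: a coherent involutive `Õ`-submodule of `Õ(Tπ)`. -/
structure IsDeformationOfFoliations (F : SubmoduleSheaf n s M) : Prop where
  coherent : F.IsCoherent
  involutive : F.IsInvolutive

/-- The stalk `F_x ⊆ Õ(Tπ)_x`. -/
def stalk (F : SubmoduleSheaf n s M) (x : M) :
    Submodule (stalkRing n s x) (tangentStalk n s x) where
  carrier := {g | ∃ (U : Opens M) (X : M → RelTangent n),
    x ∈ U ∧ F.IsSec U X ∧ (g : Germ (𝓝 x) (RelTangent n)) = ↑X}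
  zero_mem' := ⟨⊤, 0, trivial, F.zero _, rfl⟩
  add_mem' := by
    rintro ⟨_, _⟩ ⟨_, _⟩ ⟨U, X, hU, hX, rfl⟩ ⟨V, Y, hV, hY, rfl⟩
    exact ⟨U ⊓ V, X + Y, ⟨hU, hV⟩,
      F.add (F.restrict inf_le_left hX) (F.restrict inf_le_right hY), rfl⟩
  smul_mem' := by
    rintro ⟨_, V, f, hV, hf, rfl⟩ ⟨_, _⟩ ⟨U, X, hU, hX, rfl⟩
    exact ⟨V ⊓ U, fun x => f x • X x, ⟨hV, hU⟩,
      F.smul (hf.mono fun _ h => h.1) (F.restrict inf_le_right hX), rfl⟩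

/-- The stalk at `x` of the normal sheaf `N = Õ(Tπ) / F`. -/
abbrev NormalStalk (F : SubmoduleSheaf n s M) (x : M) : Type _ :=
  tangentStalk n s x ⧸ F.stalk x

/-- The singular set `S(F)`: the points where the stalk of the normal sheaf is not free. -/
def singularSet (F : SubmoduleSheaf n s M) : Set M :=
  {x | ¬ Module.Free (stalkRing n s x) (F.NormalStalk x)}

/-- `F` has rank `p`: outside the singular set (where `F` is locally free) the stalks of `F` have
rank `p`. -/
def HasRank (F : SubmoduleSheaf n s M) (p : ℕ) : Prop :=
  ∀ x ∉ F.singularSet, Module.finrank (stalkRing n s x) (F.stalk x) = p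

/-! ### The normal bundle -/

/-- The subspace of `T_xπ` of the values at `x` of sections of `F`. -/
def fiber (F : SubmoduleSheaf n s M) (x : M) : Submodule ℂ (RelTangent n) where
  carrier := {v | ∃ (U : Opens M) (X : M → RelTangent n), x ∈ U ∧ F.IsSec U X ∧ X x = v}
  zero_mem' := ⟨⊤, 0, trivial, F.zero _, rfl⟩
  add_mem' := by
    rintro _ _ ⟨U, X, hU, hX, rfl⟩ ⟨V, Y, hV, hY, rfl⟩
    exact ⟨U ⊓ V, X + Y, ⟨hU, hV⟩,
      F.add (F.restrict inf_le_left hX) (F.restrict inf_le_right hY), rfl⟩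
  smul_mem' := by
    rintro c _ ⟨U, X, hU, hX, rfl⟩
    exact ⟨U, fun x => c • X x, hU, F.smul (IsRelHol.const _ c) hX, rfl⟩

/-- The fibre at `x` of the normal bundle, the quotient of `T_xπ` by the values of `F` at `x`. -/
abbrev Normal (F : SubmoduleSheaf n s M) (x : M) : Type := RelTangent n ⧸ F.fiber x

/-- `σ` is a (global) `C^∞` section of the normal bundle, that is, of `N ⊗ C^∞`: it is locally the
class of a `C^∞` section of `Tπ`. -/
def IsSmoothSection (F : SubmoduleSheaf n s M) (σ : ∀ x : M, F.Normal x) : Prop :=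
  ∀ x : M, ∃ (U : Opens M) (Z : M → RelTangent n), x ∈ U ∧ IsSmoothRelField n s (U : Set M) Z ∧
    ∀ y ∈ U, σ y = (F.fiber y).mkQ (Z y)

end SubmoduleSheaf

/-! ### Connections on the normal bundle and their curvature -/

section Connections

variable {n s : ℕ} {M : Type*} [TopologicalSpace M] [ChartedSpace (Model n s) M]
  [IsManifold (IM n s) ∞ M]

/-- `X` is a (real, global) `C^∞` vector field on `M`. -/
def IsSmoothVectorField (X : ∀ x : M, TangentSpace (IM n s) x) : Prop :=
  ContMDiff (IM n s) (IM n s).tangent ∞ (fun x => (⟨x, X x⟩ : TangentBundle (IM n s) M))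

/-- A connection `∇ : C^∞(N) → C^∞((T*M ⊗ ℂ) ⊗ N)` on the `C^∞` complex vector bundle `N`, with
`(T*M ⊗ ℂ) ⊗ N = Hom_ℝ(TM, N)`; `toFun σ x v` is `∇_v σ` at `x`. Its values on non-smooth `σ` play
no role. The `ℂ`-linearity of `∇` follows from `add` and from `leibniz` with constant `f`. -/
structure Connection (F : SubmoduleSheaf n s M) where
  toFun : (∀ x : M, F.Normal x) → ∀ x : M, TangentSpace (IM n s) x →ₗ[ℝ] F.Normal x
  smooth : ∀ σ, F.IsSmoothSection σ → ∀ X : (∀ x : M, TangentSpace (IM n s) x),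
    IsSmoothVectorField X → F.IsSmoothSection (fun x => toFun σ x (X x))
  add : ∀ σ τ, F.IsSmoothSection σ → F.IsSmoothSection τ → ∀ x v,
    toFun (fun y => σ y + τ y) x v = toFun σ x v + toFun τ x v
  leibniz : ∀ (f : M → ℂ) σ, ContMDiff (IM n s) 𝓘(ℝ, ℂ) ∞ f → F.IsSmoothSection σ → ∀ x v,
    toFun (fun y => f y • σ y) x v =
      f x • toFun σ x v + (show ℂ from mfderiv (IM n s) 𝓘(ℝ, ℂ) f x v) • σ x

/-- A field of `End(N)`-valued bilinear forms on the tangent spaces of `M`. -/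
abbrev EndForm (F : SubmoduleSheaf n s M) : Type _ :=
  ∀ x : M, TangentSpace (IM n s) x →ₗ[ℝ] TangentSpace (IM n s) x →ₗ[ℝ] Module.End ℂ (F.Normal x)

/-- `K` is the curvature of `∇`: `K(X, Y)σ = ∇_X ∇_Y σ - ∇_Y ∇_X σ - ∇_[X,Y] σ`. This determines
`K`, as tangent vectors and elements of `N_x` extend to global smooth fields and sections. -/
def Connection.HasCurvature {F : SubmoduleSheaf n s M} (D : Connection F) (K : EndForm F) : Prop :=
  ∀ X Y : (∀ x : M, TangentSpace (IM n s) x), IsSmoothVectorField X → IsSmoothVectorField Y →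
    ∀ σ, F.IsSmoothSection σ → ∀ x,
      K x (X x) (Y x) (σ x) =
        D.toFun (fun y => D.toFun σ y (Y y)) x (X x) - D.toFun (fun y => D.toFun σ y (X y)) x (Y x)
          - D.toFun σ x (VectorField.mlieBracket (IM n s) X Y x)

end Connections

/-! ### Characteristic forms -/

section Characteristic

/-- The `k`-th elementary invariant `σ_k` of a square matrix: `det(1 + T B) = ∑ σ_k(B) T^k`. -/
def elemInvariant {ι A : Type*} [Fintype ι] [DecidableEq ι] [CommRing A]
    (k : ℕ) (B : Matrix ι ι A) : A :=
  (1 + (Polynomial.X : Polynomial A) • B.map Polynomial.C).det.coeff k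

/-- The invariant polynomial on matrices defined by a symmetric polynomial `φ` in `m` variables:
write `φ` as a polynomial `φ'` in the elementary symmetric polynomials `e₁, …, e_m` and put
`φ(B) = φ'(σ₁(B), …, σ_m(B))`. -/
def invariantPoly {ι A : Type*} [Fintype ι] [DecidableEq ι] [CommRing A] [Algebra ℂ A] {m : ℕ}
    (φ : MvPolynomial.symmetricSubalgebra (Fin m) ℂ) (B : Matrix ι ι A) : A :=
  MvPolynomial.aeval (fun k : Fin m => elemInvariant (k + 1) B)
    ((MvPolynomial.esymmAlgEquiv (Fin m) ℂ (Fintype.card_fin m)).symm φ)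

/-- The polarization of the invariant polynomial of a `φ` homogeneous of degree `d`, the symmetric
`d`-linear form `Φ` on matrices with `Φ(B, …, B) = φ(B)`: it is `1 / d!` times the coefficient of
`T₁ ⋯ T_d` in `φ(T₁ B₁ + ⋯ + T_d B_d)`. -/
def polarization {ι : Type*} [Fintype ι] [DecidableEq ι] {m : ℕ}
    (φ : MvPolynomial.symmetricSubalgebra (Fin m) ℂ) (d : ℕ) (B : Fin d → Matrix ι ι ℂ) : ℂ :=
  (d.factorial : ℂ)⁻¹ *
    MvPolynomial.coeff (Finsupp.equivFunOnFinite.symm (fun _ : Fin d => 1))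
      (invariantPoly φ (∑ k, (MvPolynomial.X k : MvPolynomial (Fin d) ℂ) •
        (B k).map MvPolynomial.C))

/-- The value on `v₁, …, v_{2d}` of the form `φ((√-1 / 2π) K)`, for `φ` symmetric and homogeneous of
degree `d` and `K` an alternating bilinear form with values in the endomorphisms of a complex vector
space `N` (in a basis of `N`: a matrix of scalar 2-forms, which commute). The product of `d` scalar
2-forms is `(ω₁ ∧ ⋯ ∧ ω_d)(v₁, …, v_{2d}) = 2⁻ᵈ ∑_τ sgn τ ∏_k ω_k(v_{τ(2k-1)}, v_{τ(2k)})`. The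
choice of the basis is irrelevant because `φ` is invariant under conjugation. -/
def charForm {V N : Type*} [AddCommGroup V] [Module ℝ V] [AddCommGroup N] [Module ℂ N]
    [FiniteDimensional ℂ N] {m : ℕ} (φ : MvPolynomial.symmetricSubalgebra (Fin m) ℂ) (d : ℕ)
    (K : V →ₗ[ℝ] V →ₗ[ℝ] Module.End ℂ N) (v : Fin (2 * d) → V) : ℂ :=
  (Complex.I / (2 * Real.pi)) ^ d * ((2 : ℂ) ^ d)⁻¹ *
    ∑ τ : Equiv.Perm (Fin (2 * d)), ((Equiv.Perm.sign τ : ℤ) : ℂ) *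
      polarization φ d fun k : Fin d =>
        LinearMap.toMatrix (Module.finBasis ℂ N) (Module.finBasis ℂ N)
          (K (v (τ ⟨2 * k, by omega⟩)) (v (τ ⟨2 * k + 1, by omega⟩)))

end Characteristic

end RelFol

end

/-! This is Bott's vanishing theorem, carried out along the fibres of `π`. Identify a real vertical
vector with its (1,0)-part in `ℂⁿ`, and let `q` be the projection of vertical vectors onto the
normal bundle `N`. The connection is chosen torsion-free along the fibres: `∇_u q(v) - ∇_v q(u) =
q([u, v])` for vertical `u`, `v`. One further derivative gives the first Bianchi identity `K(u,v)
q(w) + K(v,w) q(u) + K(w,u) q(v) = 0` (`curv_bianchi`). Letting `w` run through lifts of a basis of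
`N`, one sees that the matrix of `K`, restricted to a fibre, lies in the ideal generated by the
components `q_a` of `q`. There are `rank N ≤ n - p` of these, so in a product of `d > n - p` entries
some 1-form `q_a` occurs twice and the product is zero (`sum_sign_multilinear_eq_zero`,
`charForm_eq_zero`). The polarization of `φ` being multilinear (`polarizationMap`), the
characteristic form is a combination of such products.

The connection is first built locally. Since the stalk of the normal sheaf is free, the stalk of `F`
is a direct summand of that of `Õ(Tπ)`, and coherence spreads the projection onto `F` over a
neighbourhood (`exists_fiber_projection`). Let `Π` be the complementary projection: its kernel is
`F`, and it is holomorphic along the fibres (`exists_isTransverse`). Put `Γ(u) v = (∂_u Π) v +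
(∂_{Πv} Π) u`. The first term makes `∂_u + Γ(u)` preserve `F`, hence act on `N`: compare with the
derivative of `Π Z = 0`. The second term makes `Π Γ(u) v` symmetric in vertical `u`, `v`. This uses
involutivity, which reads `Π((∂_u Π) v - (∂_v Π) u) = 0` for `u`, `v` in the kernel of `Π`.
Holomorphy of `Π` makes `Γ(u)` complex linear.

Torsion-freeness along the fibres does not depend on the chart, because second derivatives of
coordinate changes are symmetric, and it is an affine condition. A partition of unity therefore
glues the local connections (`TransverseCover`). Finally, `rank N ≤ n - p` follows from Nakayama's
lemma, which bounds the rank of the stalk of `F` by the dimension of the space of values of its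
sections (`finrank_stalk_le`). -/

noncomputable section

namespace RelFol

/-! ### Vanishing of characteristic forms -/

section Characteristic

open MvPolynomial in
/-- `f` is affine in its argument up to `X_k²`: `f x = f₀ + X_k L(x) + X_k² h(x)`, where `f₀` does
not involve `X_k` and `L` is linear. -/
def IsAffineMod {E : Type*} [AddCommGroup E] [Module ℂ E] {d : ℕ} (k : Fin d)
    (f : E → MvPolynomial (Fin d) ℂ) : Prop :=
  ∃ f₀ ∈ MvPolynomial.supported ℂ ({k}ᶜ : Set (Fin d)), ∃ L : E →ₗ[ℂ] MvPolynomial (Fin d) ℂ,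
    ∃ h : E → MvPolynomial (Fin d) ℂ, ∀ x, f x = f₀ + X k * L x + X k ^ 2 * h x

namespace IsAffineMod

variable {E : Type*} [AddCommGroup E] [Module ℂ E] {d : ℕ} {k : Fin d}
  {f g : E → MvPolynomial (Fin d) ℂ}

theorem of_mem_supported {a : MvPolynomial (Fin d) ℂ}
    (ha : a ∈ MvPolynomial.supported ℂ ({k}ᶜ : Set (Fin d))) : IsAffineMod k fun _ : E => a :=
  ⟨a, ha, 0, 0, fun x => by simp⟩

theorem add (hf : IsAffineMod k f) (hg : IsAffineMod k g) : IsAffineMod k fun x => f x + g x := by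
  obtain ⟨f₀, hf₀, L, h, hf⟩ := hf
  obtain ⟨g₀, hg₀, L', h', hg⟩ := hg
  exact ⟨f₀ + g₀, add_mem hf₀ hg₀, L + L', h + h', fun x => by
    simp only [hf, hg, LinearMap.add_apply, Pi.add_apply]; ring⟩

theorem mul (hf : IsAffineMod k f) (hg : IsAffineMod k g) : IsAffineMod k fun x => f x * g x := by
  obtain ⟨f₀, hf₀, L, h, hf⟩ := hf
  obtain ⟨g₀, hg₀, L', h', hg⟩ := hg
  refine ⟨f₀ * g₀, mul_mem hf₀ hg₀, LinearMap.mulLeft ℂ f₀ ∘ₗ L' + LinearMap.mulLeft ℂ g₀ ∘ₗ L,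
    fun x => f₀ * h' x + L x * L' x + h x * g₀ + MvPolynomial.X k * (L x * h' x + h x * L' x)
      + MvPolynomial.X k ^ 2 * (h x * h' x), fun x => ?_⟩
  simp only [hf, hg, LinearMap.add_apply, LinearMap.comp_apply, LinearMap.mulLeft_apply]
  ring

theorem sum {ι : Type*} (s : Finset ι) {f : ι → E → MvPolynomial (Fin d) ℂ}
    (hf : ∀ i ∈ s, IsAffineMod k (f i)) : IsAffineMod k fun x => ∑ i ∈ s, f i x := by
  classical
  induction s using Finset.induction_on with
  | empty => simpa using of_mem_supported (E := E) (k := k) (zero_mem _)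
  | insert i s hi ih =>
    simp only [Finset.sum_insert hi]
    exact (hf i (Finset.mem_insert_self _ _)).add
      (ih fun j hj => hf j (Finset.mem_insert_of_mem hj))

theorem prod {ι : Type*} (s : Finset ι) {f : ι → E → MvPolynomial (Fin d) ℂ}
    (hf : ∀ i ∈ s, IsAffineMod k (f i)) : IsAffineMod k fun x => ∏ i ∈ s, f i x := by
  classical
  induction s using Finset.induction_on with
  | empty => simpa using of_mem_supported (E := E) (k := k) (one_mem _)
  | insert i s hi ih =>
    simp only [Finset.prod_insert hi]
    exact (hf i (Finset.mem_insert_self _ _)).mul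
      (ih fun j hj => hf j (Finset.mem_insert_of_mem hj))

/-- A monomial of degree exactly one in `X k` is seen only by the middle term: `f₀` does not involve
`X k`, and the last term is divisible by `X k ^ 2`. -/
theorem coeff_linear (hf : IsAffineMod k f) {e : Fin d →₀ ℕ} (he : e k = 1) :
    ∃ ℓ : E →ₗ[ℂ] ℂ, ∀ x, MvPolynomial.coeff e (f x) = ℓ x := by
  obtain ⟨f₀, hf₀, L, h, hf⟩ := hf
  refine ⟨MvPolynomial.lcoeff ℂ (e - Finsupp.single k 1) ∘ₗ L, fun x => ?_⟩
  have h0 : MvPolynomial.coeff e f₀ = 0 := by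
    by_contra hne
    have hk : k ∈ f₀.vars :=
      (MvPolynomial.mem_vars_iff_mem_support k).2 ⟨e, MvPolynomial.mem_support_iff.2 hne, by simp [he]⟩
    exact MvPolynomial.mem_supported.1 hf₀ hk rfl
  rw [hf, MvPolynomial.coeff_add, MvPolynomial.coeff_add, h0, pow_two, mul_assoc,
    MvPolynomial.coeff_X_mul', MvPolynomial.coeff_X_mul', if_pos (by simp [he]),
    if_pos (by simp [he]), MvPolynomial.coeff_X_mul', if_neg (by simp [he])]
  simp [MvPolynomial.lcoeff]

end IsAffineMod

theorem map_elemInvariant {ι A B : Type*} [Fintype ι] [DecidableEq ι] [CommRing A] [CommRing B]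
    (f : A →+* B) (k : ℕ) (N : Matrix ι ι A) :
    f (elemInvariant k N) = elemInvariant k (N.map f) := by
  unfold elemInvariant
  rw [← Polynomial.coeff_map, ← Polynomial.coe_mapRingHom, RingHom.map_det]
  congr 3
  ext i j
  by_cases hij : i = j <;> simp [hij]

/-- Naturality reduces every matrix to the generic one, so that the invariant becomes a fixed
polynomial in the matrix entries. -/
theorem map_invariantPoly {ι A B : Type*} [Fintype ι] [DecidableEq ι] [CommRing A] [CommRing B]
    [Algebra ℂ A] [Algebra ℂ B] (f : A →ₐ[ℂ] B) {m : ℕ}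
    (φ : MvPolynomial.symmetricSubalgebra (Fin m) ℂ) (N : Matrix ι ι A) :
    f (invariantPoly φ N) = invariantPoly φ (N.map f) := by
  unfold invariantPoly
  rw [← AlgHom.comp_apply, MvPolynomial.comp_aeval]
  congr 2
  ext k
  exact map_elemInvariant (f : A →+* B) _ N

/-- The invariant is a polynomial `Q` in the entries, each entry of `∑ X_l B_l` is affine in the
`k`-th matrix, and being affine modulo `X_k²` is stable under sums and products. -/
theorem isAffineMod_invariantPoly {ι : Type*} [Fintype ι] [DecidableEq ι] {m d : ℕ}
    (φ : MvPolynomial.symmetricSubalgebra (Fin m) ℂ) (k : Fin d)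
    (B : Fin d → Matrix ι ι ℂ) :
    IsAffineMod k fun N : Matrix ι ι ℂ => invariantPoly φ
      (∑ l, (MvPolynomial.X l : MvPolynomial (Fin d) ℂ) •
        (Function.update B k N l).map MvPolynomial.C) := by
  set Q : MvPolynomial (ι × ι) ℂ := invariantPoly φ (Matrix.of fun i j => MvPolynomial.X (i, j))
  have hQ (N : Matrix ι ι (MvPolynomial (Fin d) ℂ)) :
      invariantPoly φ N = MvPolynomial.aeval (fun ij : ι × ι => N ij.1 ij.2) Q := by
    rw [map_invariantPoly]
    congr 1
    ext i j
    simp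
  simp only [hQ, MvPolynomial.aeval_def, MvPolynomial.eval₂_eq']
  refine IsAffineMod.sum _ fun e _ => (IsAffineMod.of_mem_supported (Subalgebra.algebraMap_mem _ _)).mul
    (IsAffineMod.prod _ fun ij _ => ?_)
  have : IsAffineMod k fun N : Matrix ι ι ℂ => (∑ l, (MvPolynomial.X l : MvPolynomial (Fin d) ℂ) •
        (Function.update B k N l).map MvPolynomial.C) ij.1 ij.2 := by
    simp only [Matrix.sum_apply, Matrix.smul_apply, Matrix.map_apply, smul_eq_mul]
    refine IsAffineMod.sum _ fun l _ => ?_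
    by_cases hl : l = k
    · subst hl
      refine ⟨0, zero_mem _, Algebra.linearMap ℂ _ ∘ₗ LinearMap.proj ij.2 ∘ₗ
        LinearMap.proj (R := ℂ) (φ := fun _ : ι => ι → ℂ) ij.1, 0, fun N => ?_⟩
      simp [MvPolynomial.algebraMap_eq]
      rfl
    · simp only [Function.update_of_ne hl]
      exact IsAffineMod.of_mem_supported (mul_mem (MvPolynomial.X_mem_supported.2 hl)
        (Subalgebra.algebraMap_mem _ _))
  simpa using IsAffineMod.prod (Finset.range (e ij)) fun _ _ => this

/-- The polarization as a multilinear map. -/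
def polarizationMap (ι : Type*) [Fintype ι] [DecidableEq ι] {m : ℕ}
    (φ : MvPolynomial.symmetricSubalgebra (Fin m) ℂ) (d : ℕ) :
    MultilinearMap ℂ (fun _ : Fin d => Matrix ι ι ℂ) ℂ := by
  have key (k : Fin d) (B : Fin d → Matrix ι ι ℂ) : ∃ ℓ : Matrix ι ι ℂ →ₗ[ℂ] ℂ, ∀ N,
      polarization φ d (Function.update B k N) = ℓ N := by
    obtain ⟨ℓ, hℓ⟩ := (isAffineMod_invariantPoly φ k B).coeff_linear
      (e := Finsupp.equivFunOnFinite.symm fun _ : Fin d => 1) (by simp)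
    exact ⟨(d.factorial : ℂ)⁻¹ • ℓ, fun N => by simp [polarization, ← hℓ]⟩
  refine ⟨polarization φ d, fun {inst} B k N N' => ?_, fun {inst} B k c N => ?_⟩
  -- `MultilinearMap` quantifies over the decidable equality inside `Function.update`; it is
  -- identified with the one used in `key`.
  · obtain rfl : inst = fun a b => instDecidableEqFin d a b := Subsingleton.elim _ _
    obtain ⟨ℓ, hℓ⟩ := key k B
    rw [hℓ, hℓ, hℓ, map_add]
  · obtain rfl : inst = fun a b => instDecidableEqFin d a b := Subsingleton.elim _ _
    obtain ⟨ℓ, hℓ⟩ := key k B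
    rw [hℓ, hℓ, map_smul]

/-- If the matrix-valued 2-form `Ω` lies in the ideal generated by the 1-forms `q a`, for `a` in a
set of fewer than `d` elements, then its products of length `d` vanish. -/
theorem sum_sign_multilinear_eq_zero {V W α : Type*} [AddCommGroup W] [Module ℂ W] [Fintype α]
    {d : ℕ} (hd : Fintype.card α < d) (Φ : MultilinearMap ℂ (fun _ : Fin d => W) ℂ)
    (Ω : V → V → W) (q : α → V → ℂ) (C C' : α → V → W)
    (hΩ : ∀ u v, Ω u v = ∑ a, (q a u • C a v + q a v • C' a u)) (v : Fin (2 * d) → V) :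
    ∑ τ : Equiv.Perm (Fin (2 * d)), ((Equiv.Perm.sign τ : ℤ) : ℂ) *
      Φ (fun k : Fin d => Ω (v (τ ⟨2 * k, by omega⟩)) (v (τ ⟨2 * k + 1, by omega⟩))) = 0 := by
  classical
  -- The `k`-th 2-form occupies the positions `2k` and `2k + 1`. An index `i k : α × Bool` records
  -- which 1-form `q a` is taken from it and which of the two positions that 1-form occupies; the
  -- coefficient `D` takes the other.
  let slot (k : Fin d) (b : Bool) : Fin (2 * d) :=
    bif b then ⟨2 * k + 1, by omega⟩ else ⟨2 * k, by omega⟩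
  have slot_ne {k l : Fin d} (h : k ≠ l) (b b' : Bool) : slot k b ≠ slot l b' := by
    have : (k : ℕ) ≠ l := fun h' => h (Fin.ext h')
    cases b <;> cases b' <;> simp [slot] <;> omega
  have slot_ne' (k : Fin d) (b : Bool) : slot k b ≠ slot k (!b) := by
    cases b <;> simp [slot]
  let D (i : α × Bool) (x : V) : W := bif i.2 then C' i.1 x else C i.1 x
  have hΩ' (u : Fin (2 * d) → V) (k : Fin d) : Ω (u ⟨2 * k, by omega⟩) (u ⟨2 * k + 1, by omega⟩) =
      ∑ i : α × Bool, q i.1 (u (slot k i.2)) • D i (u (slot k (!i.2))) := by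
    rw [hΩ, Fintype.sum_prod_type]
    refine Finset.sum_congr rfl fun a _ => ?_
    simp [slot, D, add_comm]
  have hexp (τ : Equiv.Perm (Fin (2 * d))) :
      Φ (fun k : Fin d => Ω (v (τ ⟨2 * k, by omega⟩)) (v (τ ⟨2 * k + 1, by omega⟩))) =
        ∑ i : Fin d → α × Bool, (∏ k, q (i k).1 (v (τ (slot k (i k).2)))) *
          Φ fun k => D (i k) (v (τ (slot k (!(i k).2)))) := by
    have := fun k => hΩ' (v ∘ τ) k
    simp only [Function.comp_apply] at this
    simp only [this]
    rw [MultilinearMap.map_sum]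
    refine Finset.sum_congr rfl fun i _ => ?_
    rw [MultilinearMap.map_smul_univ, smul_eq_mul]
  simp only [hexp, Finset.mul_sum]
  rw [Finset.sum_comm]
  refine Finset.sum_eq_zero fun i _ => ?_
  -- Pigeonhole: there are fewer 1-forms than factors, so two factors use the same `q a`. Exchanging
  -- the arguments of these two copies preserves the summand except for the sign of the permutation.
  obtain ⟨k, l, hkl, hi⟩ := Fintype.exists_ne_map_eq_of_card_lt (fun k => (i k).1)
    (by simpa using hd)
  set σ : Equiv.Perm (Fin (2 * d)) := Equiv.swap (slot k (i k).2) (slot l (i l).2)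
  have hσ' (m : Fin d) : σ (slot m (!(i m).2)) = slot m (!(i m).2) := by
    apply Equiv.swap_apply_of_ne_of_ne
    · by_cases h : m = k
      · subst h; exact (slot_ne' _ _).symm
      · exact slot_ne h _ _
    · by_cases h : m = l
      · subst h; exact (slot_ne' _ _).symm
      · exact slot_ne h _ _
  have hσ (τ : Equiv.Perm (Fin (2 * d))) : ∏ m, q (i m).1 (v ((τ * σ) (slot m (i m).2))) =
      ∏ m, q (i m).1 (v (τ (slot m (i m).2))) := by
    refine Fintype.prod_equiv (Equiv.swap k l) _ _ fun m => ?_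
    rw [Equiv.Perm.mul_apply]
    by_cases h : m = k
    · subst h
      simp only [Equiv.swap_apply_left, σ]
      rw [hi]
    · by_cases h' : m = l
      · subst h'
        simp only [Equiv.swap_apply_right, σ]
        rw [hi]
      · rw [Equiv.swap_apply_of_ne_of_ne h h', Equiv.swap_apply_of_ne_of_ne (slot_ne h _ _)
          (slot_ne h' _ _)]
  -- Reindexing by `τ ↦ τ * σ` shows that the sum equals its own negative.
  refine self_eq_neg.1 ?_
  rw [← Finset.sum_neg_distrib]
  refine (Fintype.sum_equiv (Equiv.mulRight σ) _ _ fun τ => ?_)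
  have hs : Equiv.Perm.sign σ = -1 := Equiv.Perm.sign_swap (slot_ne hkl _ _)
  rw [Equiv.coe_mulRight, hσ]
  simp only [Equiv.Perm.mul_apply, hσ', map_mul, hs]
  simp

/-- A curvature form satisfying the first Bianchi identity with respect to a surjection `q` onto a
space of dimension less than `d` has vanishing characteristic forms of degree `d`. -/
theorem charForm_eq_zero {V N : Type*} [AddCommGroup V] [Module ℝ V] [AddCommGroup N] [Module ℂ N]
    [FiniteDimensional ℂ N] {m : ℕ} (φ : MvPolynomial.symmetricSubalgebra (Fin m) ℂ) {d : ℕ}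
    (hd : Module.finrank ℂ N < d) (K : V →ₗ[ℝ] V →ₗ[ℝ] Module.End ℂ N) (S : Set V) (q : V → N)
    (hq : ∀ n : N, ∃ v ∈ S, q v = n)
    (hK : ∀ u ∈ S, ∀ v ∈ S, ∀ w ∈ S, K u v (q w) + K v w (q u) + K w u (q v) = 0)
    (v : Fin (2 * d) → V) (hv : ∀ i, v i ∈ S) : charForm φ d K v = 0 := by
  set b := Module.finBasis ℂ N
  choose w hwS hw using fun c => hq (b c)
  unfold charForm
  refine mul_eq_zero_of_right _ ?_
  -- The argument takes place on the subtype `S`, where the Bianchi identity is available. With `b c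
  -- = q (w c)` it reads `K(u,v) b_c = -K(v,w_c) q(u) - K(w_c,u) q(v)`. Expanding `q(u)` and `q(v)`
  -- in the basis gives the 1-forms `q_a` and their matrix coefficients.
  refine sum_sign_multilinear_eq_zero (V := S) (by simpa using hd) (polarizationMap _ φ d)
    (fun u v => LinearMap.toMatrix b b (K u v)) (fun a u => b.repr (q u) a)
    (fun a v => Matrix.of fun i c => -b.repr (K v (w c) (b a)) i)
    (fun a u => Matrix.of fun i c => -b.repr (K (w c) u (b a)) i)
    (fun ⟨u, hu⟩ ⟨v, hv⟩ => ?_) (fun i => ⟨v i, hv i⟩)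
  ext i c
  rw [LinearMap.toMatrix_apply]
  have h := hK u hu v hv (w c) (hwS c)
  rw [hw, add_assoc] at h
  rw [eq_neg_of_add_eq_zero_left h]
  have h1 : K v (w c) (q u) = ∑ a, b.repr (q u) a • K v (w c) (b a) := by
    conv_lhs => rw [← b.sum_repr (q u), map_sum]
    simp only [map_smul]
  have h2 : K (w c) u (q v) = ∑ a, b.repr (q v) a • K (w c) u (b a) := by
    conv_lhs => rw [← b.sum_repr (q v), map_sum]
    simp only [map_smul]
  simp only [h1, h2, Matrix.sum_apply, Matrix.add_apply, Matrix.smul_apply, Matrix.of_apply,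
    map_neg, map_add, map_sum, map_smul, smul_eq_mul, Finsupp.neg_apply, Finsupp.add_apply,
    Finsupp.finsetSum_apply, Finsupp.smul_apply, Finset.sum_add_distrib, mul_neg,
    Finset.sum_neg_distrib, neg_add]

end Characteristic

/-! ### Changes of adapted charts -/

section Charts

variable {n s : ℕ} {M P : Type*} [TopologicalSpace M]

/-- The inclusion of the vertical vectors. -/
abbrev vert (n s : ℕ) : (Fin n → ℂ) →L[ℝ] Model n s :=
  ContinuousLinearMap.inl ℝ (Fin n → ℂ) (Fin s → ℝ)

/-- The change of coordinates from `e` to `e'`. -/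
def trans (e e' : OpenPartialHomeomorph M (Model n s)) (y : Model n s) : Model n s :=
  e' (e.symm y)

/-- The domain of the change of coordinates from `e` to `e'`. -/
def overlap (e e' : OpenPartialHomeomorph M (Model n s)) : Set (Model n s) :=
  e.target ∩ e.symm ⁻¹' e'.source

/-- The vertical part of the derivative of the change of coordinates. -/
def jac (e e' : OpenPartialHomeomorph M (Model n s)) (y : Model n s) :
    (Fin n → ℂ) →L[ℝ] (Fin n → ℂ) :=
  ContinuousLinearMap.fst ℝ _ _ ∘L fderiv ℝ (trans e e') y ∘L vert n s

variable {e e' e'' : OpenPartialHomeomorph M (Model n s)}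

theorem isOpen_overlap : IsOpen (overlap e e') :=
  e.isOpen_inter_preimage_symm e'.open_source

theorem mem_overlap {x : M} (hx : x ∈ e.source) (hx' : x ∈ e'.source) : e x ∈ overlap e e' :=
  ⟨e.map_source hx, by simpa [e.left_inv hx]⟩

theorem trans_apply {x : M} (hx : x ∈ e.source) : trans e e' (e x) = e' x := by
  rw [trans, e.left_inv hx]

theorem trans_mem_overlap {y : Model n s} (hy : y ∈ overlap e e') :
    trans e e' y ∈ overlap e' e :=
  ⟨e'.map_source hy.2, by
    rw [Set.mem_preimage, trans, e'.left_inv hy.2]; exact e.map_target hy.1⟩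

theorem trans_mem_overlap_of_mem {y : Model n s} (hy : y ∈ overlap e e') (hy' : y ∈ overlap e e'') :
    trans e e' y ∈ overlap e' e'' :=
  ⟨e'.map_source hy.2, by
    rw [Set.mem_preimage, trans, e'.left_inv hy.2]; exact hy'.2⟩

theorem trans_trans {y : Model n s} (hy : y ∈ overlap e e') :
    trans e' e'' (trans e e' y) = trans e e'' y := by
  rw [trans, trans, trans, e'.left_inv hy.2]

theorem trans_self {y : Model n s} (hy : y ∈ e.target) : trans e e y = y := e.right_inv hy

theorem jac_self {y : Model n s} (hy : y ∈ e.target) (w : Fin n → ℂ) : jac e e y w = w := by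
  have h : trans e e =ᶠ[𝓝 y] id := by
    filter_upwards [e.open_target.mem_nhds hy] with z hz
    exact trans_self hz
  simp [jac, h.fderiv_eq]

theorem two_le_infty : (2 : WithTop ℕ∞) ≤ ∞ :=
  WithTop.coe_le_coe.2 le_top

theorem slice_mem (y : Model n s) {S : Set (Model n s)} (hS : S ∈ 𝓝 y) :
    {z | (z, y.2) ∈ S} ∈ 𝓝 y.1 := by
  have : ContinuousAt (fun z : Fin n → ℂ => (z, y.2)) y.1 := by fun_prop
  exact this.preimage_mem_nhds hS

theorem hasFDerivAt_slice (y : Model n s) :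
    HasFDerivAt (fun z : Fin n → ℂ => ((z, y.2) : Model n s)) (vert n s) y.1 :=
  hasFDerivAt_prodMk_left y.1 y.2

variable [ChartedSpace (Model n s) M] [IsManifold (IM n s) ∞ M] [TopologicalSpace P]
  [ChartedSpace (Fin s → ℝ) P] [IsManifold (IP s) ∞ P] {π : M → P}

theorem contDiffOn_trans (he : e ∈ atlas (Model n s) M) (he' : e' ∈ atlas (Model n s) M) :
    ContDiffOn ℝ ∞ (trans e e') (overlap e e') := by
  have h := (contDiffGroupoid ∞ (IM n s)).compatible he he'
  rw [contDiffGroupoid, mem_groupoid_of_pregroupoid] at h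
  have h1 := h.1
  simp only [contDiffPregroupoid] at h1
  refine ContDiffOn.mono h1 ?_
  intro y hy
  simpa [overlap] using hy

theorem contDiffAt_trans (he : e ∈ atlas (Model n s) M) (he' : e' ∈ atlas (Model n s) M)
    {y : Model n s} (hy : y ∈ overlap e e') : ContDiffAt ℝ ∞ (trans e e') y :=
  (contDiffOn_trans he he').contDiffAt (isOpen_overlap.mem_nhds hy)

theorem differentiableAt_trans (he : e ∈ atlas (Model n s) M) (he' : e' ∈ atlas (Model n s) M)
    {y : Model n s} (hy : y ∈ overlap e e') : DifferentiableAt ℝ (trans e e') y :=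
  (contDiffAt_trans he he' hy).differentiableAt (by simp)

namespace IsDeformation

/-- Both `t`-components factor through `π`, and the chart `k` of `P` is injective, so points with
equal `t` have the same image under `π`. -/
theorem trans_snd (hπ : IsDeformation n s π) (he : e ∈ atlas (Model n s) M)
    (he' : e' ∈ atlas (Model n s) M) {y y' : Model n s} (hy : y ∈ overlap e e')
    (hy' : y' ∈ overlap e e') (h : y.2 = y'.2) : (trans e e' y).2 = (trans e e' y').2 := by
  obtain ⟨D, V, -, -, -, k, -, hks, -, hk⟩ := hπ.adapted e he
  obtain ⟨D', V', -, -, -, k', -, -, -, hk'⟩ := hπ.adapted e' he'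
  rw [trans, trans, hk' _ hy.2, hk' _ hy'.2]
  congr 1
  have h1 := hk _ (e.map_target hy.1)
  have h2 := hk _ (e.map_target hy'.1)
  rw [e.right_inv hy.1] at h1
  rw [e.right_inv hy'.1] at h2
  refine k.injOn ?_ ?_ (h1.symm.trans (h.trans h2))
  · exact hks ▸ ⟨_, e.map_target hy.1, rfl⟩
  · exact hks ▸ ⟨_, e.map_target hy'.1, rfl⟩

/-- The new `t`-component is constant on each slice `t = const`, so its vertical derivative
vanishes. Vertical vectors thus stay vertical, and the blocks `jac` compose among themselves. -/
theorem fderiv_trans_vert (hπ : IsDeformation n s π) (he : e ∈ atlas (Model n s) M)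
    (he' : e' ∈ atlas (Model n s) M) {y : Model n s} (hy : y ∈ overlap e e') (w : Fin n → ℂ) :
    fderiv ℝ (trans e e') y (w, 0) = (jac e e' y w, 0) := by
  refine Prod.ext rfl ?_
  have h1 := ((differentiableAt_trans he he' hy).hasFDerivAt.snd).comp y.1 (hasFDerivAt_slice y)
  have h2 : HasFDerivAt (fun z : Fin n → ℂ => (trans e e' (z, y.2)).2)
      (0 : (Fin n → ℂ) →L[ℝ] (Fin s → ℝ)) y.1 := by
    refine (hasFDerivAt_const (trans e e' y).2 y.1).congr_of_eventuallyEq ?_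
    filter_upwards [slice_mem y (isOpen_overlap.mem_nhds hy)] with z hz
    exact hπ.trans_snd he he' hz hy rfl
  exact DFunLike.congr_fun (h1.unique h2) w

/-- The restriction to a slice of the vertical components of a change of charts. -/
theorem hasFDerivAt_trans_slice (hπ : IsDeformation n s π) (he : e ∈ atlas (Model n s) M)
    (he' : e' ∈ atlas (Model n s) M) {y : Model n s} (hy : y ∈ overlap e e') :
    ∃ A : (Fin n → ℂ) →L[ℂ] (Fin n → ℂ), A.restrictScalars ℝ = jac e e' y ∧
      HasFDerivAt (fun z => (trans e e' (z, y.2)).1) A y.1 := by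
  have h0 : DifferentiableAt ℂ (fun z => (trans e e' (z, y.2)).1) y.1 :=
    (hπ.holomorphic e he e' he' y.2).differentiableAt (slice_mem y (isOpen_overlap.mem_nhds hy))
  refine ⟨_, ?_, h0.hasFDerivAt⟩
  have h1 := ((differentiableAt_trans he he' hy).hasFDerivAt.comp y.1 (hasFDerivAt_slice y)).fst
  exact (h0.hasFDerivAt.restrictScalars ℝ).unique h1

theorem jac_I_smul (hπ : IsDeformation n s π) (he : e ∈ atlas (Model n s) M)
    (he' : e' ∈ atlas (Model n s) M) {y : Model n s} (hy : y ∈ overlap e e') (c : ℂ)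
    (w : Fin n → ℂ) : jac e e' y (c • w) = c • jac e e' y w := by
  obtain ⟨A, hA, -⟩ := hπ.hasFDerivAt_trans_slice he he' hy
  rw [← hA]
  exact A.map_smul c w

theorem jac_comp (hπ : IsDeformation n s π) (he : e ∈ atlas (Model n s) M)
    (he' : e' ∈ atlas (Model n s) M) (he'' : e'' ∈ atlas (Model n s) M) {y : Model n s}
    (hy : y ∈ overlap e e') (hy' : y ∈ overlap e e'') (w : Fin n → ℂ) :
    jac e' e'' (trans e e' y) (jac e e' y w) = jac e e'' y w := by
  have h1 := (differentiableAt_trans he' he'' (trans_mem_overlap_of_mem hy hy')).hasFDerivAt.comp y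
    (differentiableAt_trans he he' hy).hasFDerivAt
  have h2 : trans e' e'' ∘ trans e e' =ᶠ[𝓝 y] trans e e'' := by
    filter_upwards [isOpen_overlap.mem_nhds hy] with z hz
    exact trans_trans hz
  have h3 := (h1.congr_of_eventuallyEq h2.symm).fderiv
  have h4 := congrArg (fun L => (L (w, 0)).1) h3
  simp only [ContinuousLinearMap.comp_apply, hπ.fderiv_trans_vert he he' hy] at h4
  exact h4.symm

theorem relJacobian_eq (hπ : IsDeformation n s π) (he : e ∈ atlas (Model n s) M) {x : M}
    (hx : x ∈ e.source) (v : RelTangent n) :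
    relJacobian n s e x v = jac (chartAt (Model n s) x) e (chartAt (Model n s) x x) v := by
  obtain ⟨A, hA, h⟩ := hπ.hasFDerivAt_trans_slice (chart_mem_atlas (Model n s) x) he
    (mem_overlap (mem_chart_source (Model n s) x) hx)
  rw [← hA]
  exact DFunLike.congr_fun h.fderiv v

theorem relJacobian_chartAt (hπ : IsDeformation n s π) (x : M) (v : RelTangent n) :
    relJacobian n s (chartAt (Model n s) x) x v = v := by
  rw [hπ.relJacobian_eq (chart_mem_atlas _ x) (mem_chart_source _ x),
    jac_self (mem_chart_target _ x)]

theorem jac_relJacobian (hπ : IsDeformation n s π) (he : e ∈ atlas (Model n s) M)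
    (he' : e' ∈ atlas (Model n s) M) {x : M} (hx : x ∈ e.source) (hx' : x ∈ e'.source)
    (v : RelTangent n) : jac e e' (e x) (relJacobian n s e x v) = relJacobian n s e' x v := by
  have hc := chart_mem_atlas (Model n s) x
  have hxc := mem_chart_source (Model n s) x
  rw [hπ.relJacobian_eq he hx, hπ.relJacobian_eq he' hx', ← trans_apply (e' := e) hxc,
    hπ.jac_comp hc he he' (mem_overlap hxc hx) (mem_overlap hxc hx')]

end IsDeformation

/-- The vector of `T_xπ` with given components with respect to the frame of the chart `e`. -/
def ofComponents (e : OpenPartialHomeomorph M (Model n s)) (x : M) :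
    (Fin n → ℂ) →L[ℝ] RelTangent n :=
  jac e (chartAt (Model n s) x) (e x)

namespace IsDeformation

theorem relJacobian_ofComponents (hπ : IsDeformation n s π) (he : e ∈ atlas (Model n s) M)
    (he' : e' ∈ atlas (Model n s) M) {x : M} (hx : x ∈ e.source) (hx' : x ∈ e'.source)
    (w : Fin n → ℂ) : relJacobian n s e' x (ofComponents e x w) = jac e e' (e x) w := by
  have hc := chart_mem_atlas (Model n s) x
  have hxc := mem_chart_source (Model n s) x
  rw [hπ.relJacobian_eq he' hx', ofComponents, ← trans_apply (e' := chartAt (Model n s) x) hx,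
    hπ.jac_comp he hc he' (mem_overlap hx hxc) (mem_overlap hx hx')]

theorem ofComponents_relJacobian (hπ : IsDeformation n s π) (he : e ∈ atlas (Model n s) M)
    {x : M} (hx : x ∈ e.source) (v : RelTangent n) :
    ofComponents e x (relJacobian n s e x v) = v := by
  rw [ofComponents, hπ.jac_relJacobian he (chart_mem_atlas _ x) hx (mem_chart_source _ x),
    hπ.relJacobian_chartAt]

theorem relJacobian_ofComponents_self (hπ : IsDeformation n s π) (he : e ∈ atlas (Model n s) M)
    {x : M} (hx : x ∈ e.source) (w : Fin n → ℂ) :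
    relJacobian n s e x (ofComponents e x w) = w := by
  rw [hπ.relJacobian_ofComponents he he hx hx, jac_self (e.map_source hx)]

theorem ofComponents_smul (hπ : IsDeformation n s π) (he : e ∈ atlas (Model n s) M)
    {x : M} (hx : x ∈ e.source) (c : ℂ) (w : Fin n → ℂ) :
    ofComponents e x (c • w) = c • ofComponents e x w :=
  hπ.jac_I_smul he (chart_mem_atlas _ x) (mem_overlap hx (mem_chart_source _ x)) c w

theorem ofComponents_jac (hπ : IsDeformation n s π) (he : e ∈ atlas (Model n s) M)
    (he' : e' ∈ atlas (Model n s) M) {x : M} (hx : x ∈ e.source) (hx' : x ∈ e'.source)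
    (w : Fin n → ℂ) : ofComponents e' x (jac e e' (e x) w) = ofComponents e x w := by
  rw [← hπ.relJacobian_ofComponents he he' hx hx', hπ.ofComponents_relJacobian he' hx']

omit [IsManifold (IM n s) ∞ M] in
theorem ofComponents_chartAt (x : M) (w : Fin n → ℂ) :
    ofComponents (chartAt (Model n s) x) x w = w :=
  jac_self (mem_chart_target _ x) w

end IsDeformation

theorem contDiffOn_jac (he : e ∈ atlas (Model n s) M) (he' : e' ∈ atlas (Model n s) M) :
    ContDiffOn ℝ ∞ (jac e e') (overlap e e') :=
  contDiffOn_const.clm_comp (((contDiffOn_trans he he').fderiv_of_isOpen isOpen_overlap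
    (by simp)).clm_comp contDiffOn_const)

theorem differentiableAt_jac (he : e ∈ atlas (Model n s) M) (he' : e' ∈ atlas (Model n s) M)
    {y : Model n s} (hy : y ∈ overlap e e') : DifferentiableAt ℝ (jac e e') y :=
  ((contDiffOn_jac he he').contDiffAt (isOpen_overlap.mem_nhds hy)).differentiableAt (by simp)

theorem fderiv_jac_apply (he : e ∈ atlas (Model n s) M) (he' : e' ∈ atlas (Model n s) M)
    {y : Model n s} (hy : y ∈ overlap e e') (u : Model n s) (v : Fin n → ℂ) :
    fderiv ℝ (jac e e') y u v = (fderiv ℝ (fderiv ℝ (trans e e')) y u (v, 0)).1 := by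
  have h : DifferentiableAt ℝ (fderiv ℝ (trans e e')) y :=
    ((contDiffAt_trans he he' hy).fderiv_right (m := 1)
      (by rw [one_add_one_eq_two]; exact two_le_infty)).differentiableAt (by simp)
  have h1 := (hasFDerivAt_const (ContinuousLinearMap.fst ℝ (Fin n → ℂ) (Fin s → ℝ)) y).clm_comp
    (h.hasFDerivAt.clm_comp (hasFDerivAt_const (vert n s) y))
  have h2 : HasFDerivAt (jac e e') _ y := h1
  rw [h2.fderiv]
  simp

/-- Symmetry of the second derivative, restricted to vertical directions. It serves three times: the
coordinate frames are holomorphic along the fibres, the bracket is independent of the chart, and so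
is the vanishing of the torsion. -/
theorem fderiv_jac_symm (he : e ∈ atlas (Model n s) M) (he' : e' ∈ atlas (Model n s) M)
    {y : Model n s} (hy : y ∈ overlap e e') (u v : Fin n → ℂ) :
    fderiv ℝ (jac e e') y (u, 0) v = fderiv ℝ (jac e e') y (v, 0) u := by
  rw [fderiv_jac_apply he he' hy, fderiv_jac_apply he he' hy,
    ((contDiffAt_trans he he' hy).isSymmSndFDerivAt (by simpa using two_le_infty)).eq]

theorem IsDeformation.fderiv_jac_smul (hπ : IsDeformation n s π) (he : e ∈ atlas (Model n s) M)
    (he' : e' ∈ atlas (Model n s) M) {y : Model n s} (hy : y ∈ overlap e e') (u : Model n s) (c : ℂ)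
    (v : Fin n → ℂ) : fderiv ℝ (jac e e') y u (c • v) = c • fderiv ℝ (jac e e') y u v := by
  have h := differentiableAt_jac he he' hy
  have h1 : fderiv ℝ (fun z => jac e e' z (c • v)) y = fderiv ℝ (fun z => c • jac e e' z v) y := by
    refine Filter.EventuallyEq.fderiv_eq ?_
    filter_upwards [isOpen_overlap.mem_nhds hy] with z hz
    exact hπ.jac_I_smul he he' hz c v
  have h2 := h.hasFDerivAt.clm_apply (hasFDerivAt_const (c • v) y)
  have h3 := (h.hasFDerivAt.clm_apply (hasFDerivAt_const v y)).const_smul c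
  have h4 := DFunLike.congr_fun ((h2.fderiv.symm.trans h1).trans h3.fderiv) u
  simpa using h4

end Charts

/-! ### Relatively holomorphic functions in adapted charts -/

section RelHol

variable {n s : ℕ} {M P : Type*} [TopologicalSpace M] [ChartedSpace (Model n s) M]
  [IsManifold (IM n s) ∞ M] [TopologicalSpace P]
  [ChartedSpace (Fin s → ℝ) P] [IsManifold (IP s) ∞ P] {π : M → P}
  {e e' : OpenPartialHomeomorph M (Model n s)}

/-- A smooth function on `M` read in a chart. -/
theorem contDiffOn_comp_symm {G : Type*} [NormedAddCommGroup G] [NormedSpace ℝ G] {U : Set M}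
    {f : M → G} (he : e ∈ atlas (Model n s) M) (hf : ContMDiffOn (IM n s) 𝓘(ℝ, G) ∞ f U) :
    ContDiffOn ℝ ∞ (fun y => f (e.symm y)) (e.target ∩ e.symm ⁻¹' U) := by
  rw [← contMDiffOn_iff_contDiffOn]
  exact hf.comp' (contMDiffOn_symm_of_mem_maximalAtlas
    (IsManifold.subset_maximalAtlas he : e ∈ IsManifold.maximalAtlas (IM n s) ∞ M))

theorem contMDiffOn_of_comp_symm {G : Type*} [NormedAddCommGroup G] [NormedSpace ℝ G] {U : Set M}
    {f : M → G} (he : e ∈ atlas (Model n s) M) (hU : U ⊆ e.source)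
    (hf : ContDiffOn ℝ ∞ (fun y => f (e.symm y)) (e.target ∩ e.symm ⁻¹' U)) :
    ContMDiffOn (IM n s) 𝓘(ℝ, G) ∞ f U := by
  rw [← contMDiffOn_iff_contDiffOn] at hf
  have h := hf.comp ((contMDiffOn_of_mem_maximalAtlas
    (IsManifold.subset_maximalAtlas he : e ∈ IsManifold.maximalAtlas (IM n s) ∞ M)).mono hU)
    fun x hx => ⟨e.map_source (hU hx), by simpa [e.left_inv (hU hx)] using hx⟩
  exact h.congr fun x hx => by simp [e.left_inv (hU hx)]

theorem IsRelHol.fderiv_smul {U : Set M} (hU : IsOpen U) {f : M → ℂ} (hf : IsRelHol n s U f)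
    (he : e ∈ atlas (Model n s) M) {y : Model n s} (hy : y ∈ e.target ∩ e.symm ⁻¹' U) (c : ℂ)
    (w : Fin n → ℂ) : fderiv ℝ (fun y => f (e.symm y)) y (c • w, 0) =
      c • fderiv ℝ (fun y => f (e.symm y)) y (w, 0) := by
  have ho := (e.isOpen_inter_preimage_symm hU).mem_nhds hy
  have h1 := (((contDiffOn_comp_symm he hf.smooth).contDiffAt ho).differentiableAt
    (by simp)).hasFDerivAt.comp y.1 (hasFDerivAt_slice y)
  have h2 : DifferentiableAt ℂ (fun z => f (e.symm (z, y.2))) y.1 :=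
    (hf.holomorphic e he y.2).differentiableAt (slice_mem y ho)
  have h3 := DFunLike.congr_fun ((h2.hasFDerivAt.restrictScalars ℝ).unique h1)
  have h4 := h3 (c • w)
  have h5 := h3 w
  simp only [ContinuousLinearMap.coe_restrictScalars', ContinuousLinearMap.comp_apply,
    ContinuousLinearMap.inl_apply] at h4 h5
  rw [← h4, ← h5, ContinuousLinearMap.map_smul]

/-- A single chart suffices to check fibrewise holomorphy: in another chart the vertical derivative
is composed with `jac`, which is complex linear. -/
theorem IsDeformation.isRelHol_of_chart (hπ : IsDeformation n s π) {U : Set M} (hU : IsOpen U)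
    {f : M → ℂ} (he : e ∈ atlas (Model n s) M) (hUe : U ⊆ e.source)
    (hf : ContDiffOn ℝ ∞ (fun y => f (e.symm y)) (e.target ∩ e.symm ⁻¹' U))
    (hf' : ∀ y ∈ e.target ∩ e.symm ⁻¹' U, ∀ (c : ℂ) (w : Fin n → ℂ),
      fderiv ℝ (fun y => f (e.symm y)) y (c • w, 0) =
        c • fderiv ℝ (fun y => f (e.symm y)) y (w, 0)) : IsRelHol n s U f := by
  refine ⟨contMDiffOn_of_comp_symm he hUe hf, fun e' he' t z hz => ?_⟩
  have hzo : ((z, t) : Model n s) ∈ overlap e' e := ⟨hz.1, hUe hz.2⟩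
  have hy : trans e' e (z, t) ∈ e.target ∩ e.symm ⁻¹' U :=
    ⟨e.map_source hzo.2, by rw [Set.mem_preimage, trans, e.left_inv hzo.2]; exact hz.2⟩
  have h1 := ((hf.contDiffAt ((e.isOpen_inter_preimage_symm hU).mem_nhds hy)).differentiableAt
    (by simp)).hasFDerivAt
  have h2 := (h1.comp _ (differentiableAt_trans he' he hzo).hasFDerivAt).comp z
    (hasFDerivAt_slice (z, t))
  have h3 : (fun z => f (e'.symm (z, t))) =ᶠ[𝓝 z]
      ((fun y => f (e.symm y)) ∘ trans e' e) ∘ fun z => (z, t) := by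
    filter_upwards [slice_mem (z, t) (isOpen_overlap.mem_nhds hzo)] with z' hz'
    simp [trans, e.left_inv hz'.2]
  have h4 := h2.congr_of_eventuallyEq h3
  refine DifferentiableAt.differentiableWithinAt ⟨⟨⟨⟨_, map_add (fderiv ℝ (fun z => f (e'.symm (z, t))) z)⟩, fun c w => ?_⟩, (fderiv ℝ (fun z => f (e'.symm (z, t))) z).cont⟩,
    hasFDerivAt_of_restrictScalars ℝ h4.differentiableAt.hasFDerivAt (by ext; rfl)⟩
  have h5 (w : Fin n → ℂ) : fderiv ℝ (fun z => f (e'.symm (z, t))) z w =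
      fderiv ℝ (fun y => f (e.symm y)) (trans e' e (z, t)) (jac e' e (z, t) w, 0) := by
    rw [h4.fderiv, ← hπ.fderiv_trans_vert he' he hzo]
    rfl
  simp only [h5, RingHom.id_apply]
  rw [hπ.jac_I_smul he' he hzo, hf' _ hy]

/-- The frame `∂/∂z₁, …, ∂/∂zₙ` of a chart. -/
def frame (e : OpenPartialHomeomorph M (Model n s)) (j : Fin n) (x : M) : RelTangent n :=
  ofComponents e x (Pi.single j 1)

/-- In another chart the components form a column of `jac`. Symmetry of second derivatives exchanges
the direction of differentiation with the argument of `jac`, in which complex linearity is known. -/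
theorem IsDeformation.isRelHolField_frame (hπ : IsDeformation n s π)
    (he : e ∈ atlas (Model n s) M) (j : Fin n) : IsRelHolField n s e.source (frame e j) := by
  intro e' he' i
  have hsub : e.target ∩ e.symm ⁻¹' (e.source ∩ e'.source) ⊆ overlap e e' := fun y hy =>
    ⟨hy.1, hy.2.2⟩
  have key : ∀ y ∈ e.target ∩ e.symm ⁻¹' (e.source ∩ e'.source),
      components n s e' (frame e j) (e.symm y) i = jac e e' y (Pi.single j 1) i := by
    intro y hy
    rw [components, frame, hπ.relJacobian_ofComponents he he' hy.2.1 hy.2.2, e.right_inv hy.1]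
  have ho : IsOpen (e.source ∩ e'.source) := e.open_source.inter e'.open_source
  refine hπ.isRelHol_of_chart ho he Set.inter_subset_left ?_ fun y hy c w => ?_
  · refine ContDiffOn.congr ?_ key
    exact contDiffOn_pi.1 ((contDiffOn_jac he he').clm_apply contDiffOn_const |>.mono hsub) i
  · have h1 : (fun y => components n s e' (frame e j) (e.symm y) i) =ᶠ[𝓝 y]
        fun y => jac e e' y (Pi.single j 1) i := by
      filter_upwards [(e.isOpen_inter_preimage_symm ho).mem_nhds hy] with z hz using key z hz
    have h2 := hasFDerivAt_pi'.1 ((differentiableAt_jac he he' (hsub hy)).hasFDerivAt.clm_apply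
      (hasFDerivAt_const (Pi.single j (1 : ℂ)) y)) i
    have h3 (w : Fin n → ℂ) : fderiv ℝ (fun y => components n s e' (frame e j) (e.symm y) i) y
        (w, 0) = fderiv ℝ (jac e e') y (w, 0) (Pi.single j 1) i := by
      rw [h1.fderiv_eq, h2.fderiv]
      simp
    rw [h3, h3, fderiv_jac_symm he he' (hsub hy), hπ.fderiv_jac_smul he he' (hsub hy),
      fderiv_jac_symm he he' (hsub hy)]
    rfl

theorem IsDeformation.eq_sum_frame (hπ : IsDeformation n s π) (he : e ∈ atlas (Model n s) M)
    {x : M} (hx : x ∈ e.source) (v : RelTangent n) :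
    v = ∑ j, relJacobian n s e x v j • frame e j x := by
  conv_lhs => rw [← hπ.ofComponents_relJacobian he hx v]
  rw [← Finset.univ_sum_single (relJacobian n s e x v), map_sum]
  refine Finset.sum_congr rfl fun j _ => ?_
  rw [frame, ← hπ.ofComponents_smul he hx, Finset.univ_sum_single]
  simp [← Pi.single_smul]

omit [IsManifold (IM n s) ∞ M] in
theorem IsRelHol.inv {U : Set M} {f : M → ℂ} (hf : IsRelHol n s U f) (h0 : ∀ x ∈ U, f x ≠ 0) :
    IsRelHol n s U f⁻¹ :=
  ⟨fun x hx => ((contDiffAt_inv ℝ (h0 x hx)).contMDiffAt).comp_contMDiffWithinAt x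
      (hf.smooth x hx),
    fun e he t => (hf.holomorphic e he t).inv fun _ hz => h0 _ hz.2⟩

end RelHol

/-! ### The structure of the stalks -/

section Stalks

variable {n s : ℕ} {M P : Type*} [TopologicalSpace M] [ChartedSpace (Model n s) M]

theorem germ_sum {X G ι : Type*} [TopologicalSpace X] [AddCommMonoid G] {x : X} (t : Finset ι)
    (f : ι → X → G) : ((fun y => ∑ i ∈ t, f i y : X → G) : Germ (𝓝 x) G) = ∑ i ∈ t, ↑(f i) := by
  classical
  induction t using Finset.induction_on with
  | empty => rfl
  | insert i t hi ih =>
    rw [Finset.sum_insert hi, ← ih, ← Germ.coe_add]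
    congr 1
    ext y
    simp [Finset.sum_insert hi]

instance (x : M) : Module (stalkRing n s x) (tangentStalk n s x) :=
  (tangentStalk n s x).module

instance (x : M) : SMul (stalkRing n s x) (tangentStalk n s x) :=
  (inferInstance : Module (stalkRing n s x) (tangentStalk n s x)).toSMul

/-- The germ of a section of `Õ`. -/
def stalkRing.mk {x : M} (U : Opens M) (hx : x ∈ U) (f : M → ℂ)
    (hf : IsRelHol n s (U : Set M) f) : stalkRing n s x :=
  ⟨↑f, U, f, hx, hf, rfl⟩

/-- The value at `x` of a germ. -/
def stalkRing.eval (x : M) : stalkRing n s x →+* ℂ :=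
  (Germ.valueRingHom (x := x)).comp (stalkRing n s x).subtype

/-- The germ of a section of `Õ(Tπ)`. -/
def tangentStalk.mk {x : M} (U : Opens M) (hx : x ∈ U) (X : M → RelTangent n)
    (hX : IsRelHolField n s (U : Set M) X) : tangentStalk n s x :=
  ⟨↑X, U, X, hx, hX, rfl⟩

theorem stalkRing.isUnit_of_eval_ne_zero {x : M} (g : stalkRing n s x)
    (hg : stalkRing.eval x g ≠ 0) : IsUnit g := by
  obtain ⟨_, U, f, hU, hf, rfl⟩ := g
  have hfx : f x ≠ 0 := hg
  have ho : IsOpen ((U : Set M) ∩ f ⁻¹' {0}ᶜ) :=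
    hf.smooth.continuousOn.isOpen_inter_preimage U.isOpen isOpen_compl_singleton
  have hmem : x ∈ (⟨_, ho⟩ : Opens M) := ⟨hU, hfx⟩
  have hinv : IsRelHol n s ((U : Set M) ∩ f ⁻¹' {0}ᶜ) f⁻¹ :=
    (hf.mono Set.inter_subset_left).inv fun y hy => hy.2
  refine isUnit_iff_exists_inv.2 ⟨stalkRing.mk ⟨_, ho⟩ hmem _ hinv, Subtype.ext ?_⟩
  refine Germ.coe_eq.2 ?_
  filter_upwards [ho.mem_nhds hmem] with y hy
  exact mul_inv_cancel₀ hy.2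

/-- The germs vanishing at `x` are contained in the Jacobson radical of the stalk. -/
theorem stalkRing.ker_eval_le_jacobson (x : M) :
    RingHom.ker (stalkRing.eval (n := n) (s := s) x) ≤ Ideal.jacobson ⊥ := by
  intro g hg
  rw [Ideal.mem_jacobson_bot]
  intro a
  apply stalkRing.isUnit_of_eval_ne_zero
  rw [map_add, map_mul, RingHom.mem_ker.1 hg]
  simp

variable [IsManifold (IM n s) ∞ M] [TopologicalSpace P]
  [ChartedSpace (Fin s → ℝ) P] [IsManifold (IP s) ∞ P] {π : M → P}

/-- The germ of the `j`-th vector field of the frame of the preferred chart. -/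
def frameGerm (hπ : IsDeformation n s π) (x : M) (j : Fin n) : tangentStalk n s x :=
  tangentStalk.mk ⟨(chartAt (Model n s) x).source, (chartAt (Model n s) x).open_source⟩
    (mem_chart_source _ x) (frame (chartAt (Model n s) x) j)
    (hπ.isRelHolField_frame (chart_mem_atlas _ x) j)

/-- The germ of the `j`-th component of a section. -/
def componentGerm {x : M} (U : Opens M) (hx : x ∈ U) (X : M → RelTangent n)
    (hX : IsRelHolField n s (U : Set M) X) (j : Fin n) : stalkRing n s x :=
  stalkRing.mk (U ⊓ ⟨(chartAt (Model n s) x).source, (chartAt (Model n s) x).open_source⟩)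
    ⟨hx, mem_chart_source _ x⟩ (fun y => components n s (chartAt (Model n s) x) X y j)
    (hX _ (chart_mem_atlas _ x) j)

/-- An endomorphism of the stalk is therefore determined by its values on the `n` frame germs. -/
theorem tangentStalk_mk_eq_sum (hπ : IsDeformation n s π) {x : M} (U : Opens M) (hx : x ∈ U)
    (X : M → RelTangent n) (hX : IsRelHolField n s (U : Set M) X) :
    tangentStalk.mk U hx X hX = ∑ j, componentGerm U hx X hX j • frameGerm hπ x j := by
  apply Subtype.ext
  rw [AddSubmonoidClass.coe_finsetSum]
  trans ((fun y => ∑ j, components n s (chartAt (Model n s) x) X y j •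
    frame (chartAt (Model n s) x) j y : M → RelTangent n) : Germ (𝓝 x) (RelTangent n))
  · refine Germ.coe_eq.2 ?_
    filter_upwards [chart_source_mem_nhds (Model n s) x] with y hy
    exact hπ.eq_sum_frame (chart_mem_atlas _ x) hy (X y)
  · rw [germ_sum]
    rfl

namespace SubmoduleSheaf

variable {F : SubmoduleSheaf n s M}

omit [IsManifold (IM n s) ∞ M] in
theorem mk_mem_stalk {x : M} {U : Opens M} (hx : x ∈ U) {X : M → RelTangent n}
    (hX : F.IsSec U X) : tangentStalk.mk U hx X (F.isRelHolField hX) ∈ F.stalk x :=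
  ⟨U, X, hx, hX, rfl⟩

omit [IsManifold (IM n s) ∞ M] in
/-- If the stalk of the normal sheaf is free, the stalk of `F` is a direct summand. -/
theorem exists_projection {x : M} (hx : x ∉ F.singularSet) :
    ∃ p : tangentStalk n s x →ₗ[stalkRing n s x] tangentStalk n s x,
      (∀ g, p g ∈ F.stalk x) ∧ ∀ g ∈ F.stalk x, p g = g := by
  have hfree : Module.Free (stalkRing n s x) (F.NormalStalk x) := not_not.1 hx
  -- A free quotient is projective, so the quotient map has a section `q`; subtracting from each
  -- germ the lift of its class leaves a projection onto the stalk of `F`.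
  obtain ⟨q, hq⟩ := Module.projective_lifting_property (F.stalk x).mkQ LinearMap.id
    (Submodule.mkQ_surjective _)
  refine ⟨LinearMap.id - q ∘ₗ (F.stalk x).mkQ, fun g => ?_, fun g hg => ?_⟩
  · have h := DFunLike.congr_fun hq ((F.stalk x).mkQ g)
    refine (Submodule.Quotient.mk_eq_zero _).1 ?_
    change (F.stalk x).mkQ (g - q ((F.stalk x).mkQ g)) = 0
    rw [map_sub, sub_eq_zero]
    exact h.symm
  · have : (F.stalk x).mkQ g = 0 := by simpa using hg
    simp [this]

/-- Near a nonsingular point, there are sections `X₁, …, Xₙ` of `F` such that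
`v ↦ ∑ vⱼ Xⱼ` is a projection onto `F`. -/
theorem exists_projecting_sections (hπ : IsDeformation n s π) {x : M} (hx : x ∉ F.singularSet) :
    ∃ (U : Opens M) (hxU : x ∈ U) (X : Fin n → M → RelTangent n) (hX : ∀ j, F.IsSec U (X j)),
      ∀ (V : Opens M) (hxV : x ∈ V) (Y : M → RelTangent n) (hY : F.IsSec V Y),
        tangentStalk.mk V hxV Y (F.isRelHolField hY) =
          ∑ j, componentGerm V hxV Y (F.isRelHolField hY) j •
            tangentStalk.mk U hxU (X j) (F.isRelHolField (hX j)) := by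
  obtain ⟨p, hp, hpF⟩ := exists_projection hx
  -- The fields `X j` represent the images of the frame germs under the projection.
  choose U X hxU hX hpX using fun j => hp (frameGerm hπ x j)
  have hU : IsOpen (⋂ j, (U j : Set M)) := isOpen_iInter_of_finite fun j => (U j).isOpen
  have hle (j : Fin n) : (⟨_, hU⟩ : Opens M) ≤ U j := Set.iInter_subset _ j
  refine ⟨⟨_, hU⟩, Set.mem_iInter.2 hxU, X, fun j => F.restrict (hle j) (hX j),
    fun V hxV Y hY => ?_⟩
  rw [← hpF _ (mk_mem_stalk hxV hY)]
  conv_lhs => rw [tangentStalk_mk_eq_sum hπ, map_sum]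
  refine Finset.sum_congr rfl fun j _ => ?_
  rw [map_smul]
  congr 1
  exact Subtype.ext (hpX j)

/-- Near a nonsingular point, there are sections `X₁, …, Xₙ` of `F` such that
`v ↦ ∑ vⱼ Xⱼ` is a projection onto the fibres of `F`. -/
theorem exists_fiber_projection (hπ : IsDeformation n s π) (hF : F.IsCoherent) {x : M}
    (hx : x ∉ F.singularSet) : ∃ (U : Opens M), x ∈ U ∧
      (U : Set M) ⊆ (chartAt (Model n s) x).source ∧
      ∃ X : Fin n → M → RelTangent n, (∀ j, F.IsSec U (X j)) ∧
        ∀ y ∈ U, ∀ v ∈ F.fiber y,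
          ∑ j, relJacobian n s (chartAt (Model n s) x) y v j • X j y = v := by
  obtain ⟨U, hxU, X, hX, h⟩ := exists_projecting_sections hπ hx
  obtain ⟨V, hxV, q, -, G, -, hG, -, -, hgen, -⟩ := hF x
  -- The projection formula is an identity of germs at `x` only. For the finitely many generators
  -- given by coherence it holds on a common neighbourhood.
  have h1 (i : Fin q) : ∀ᶠ y in 𝓝 x, G i y =
      ∑ j, components n s (chartAt (Model n s) x) (G i) y j • X j y := by
    have h2 := congrArg Subtype.val (h V hxV (G i) (hG i))
    rw [AddSubmonoidClass.coe_finsetSum] at h2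
    refine Germ.coe_eq.1 (h2.trans ?_)
    rw [germ_sum]
    rfl
  obtain ⟨W, hW, hWo, hxW⟩ := eventually_nhds_iff.1 (eventually_all.2 h1)
  have hc := (chartAt (Model n s) x).open_source
  let N : Opens M := V ⊓ U ⊓ ⟨W, hWo⟩ ⊓ ⟨_, hc⟩
  refine ⟨N, ⟨⟨⟨hxV, hxU⟩, hxW⟩, mem_chart_source _ x⟩, fun y hy => hy.2, X,
    fun j => F.restrict (fun y hy => hy.1.1.2) (hX j), fun y hy v hv => ?_⟩
  obtain ⟨V', Y, hyV', hY, rfl⟩ := hv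
  -- At a nearby point `y` every section of `F` is a combination of the generators, so the formula
  -- passes to all of the fibre at `y` by linearity.
  obtain ⟨W', hyW', -, f, -, hf⟩ := hgen (V' ⊓ V) inf_le_right Y (F.restrict inf_le_left hY) y
    ⟨hyV', hy.1.1.1⟩
  rw [hf y hyW']
  simp only [map_sum, map_smul, Finset.sum_apply, Finset.sum_smul, Pi.smul_apply, smul_eq_mul,
    mul_smul]
  rw [Finset.sum_comm]
  refine Finset.sum_congr rfl fun i _ => ?_
  rw [← Finset.smul_sum]
  congr 1
  exact (hW y hy.1.2 i).symm

/-- The rank of the stalk of `F` at a nonsingular point is at most the dimension of the fibre. -/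
theorem finrank_stalk_le (hπ : IsDeformation n s π) {x : M} (hx : x ∉ F.singularSet) :
    Module.finrank (stalkRing n s x) (F.stalk x) ≤ Module.finrank ℂ (F.fiber x) := by
  obtain ⟨U, hxU, X, hX, h⟩ := exists_projecting_sections hπ hx
  set b := Module.finBasis ℂ (F.fiber x)
  choose V Y hxV hY hYb using fun i => (b i).2
  let y (i) : tangentStalk n s x := tangentStalk.mk (V i) (hxV i) (Y i) (F.isRelHolField (hY i))
  set S := Submodule.span (stalkRing n s x) (Set.range y)
  have hfg : (F.stalk x).FG := by
    let X' (j) := tangentStalk.mk U hxU (X j) (F.isRelHolField (hX j))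
    have : F.stalk x = Submodule.span (stalkRing n s x) (Set.range X') := by
      refine le_antisymm ?_ (Submodule.span_le.2 ?_)
      · rintro ⟨_, _⟩ ⟨V, Y, hxV, hY, rfl⟩
        change tangentStalk.mk V hxV Y (F.isRelHolField hY) ∈ _
        rw [h V hxV Y hY]
        exact Submodule.sum_mem _ fun j _ => Submodule.smul_mem _ _
          (Submodule.subset_span ⟨j, rfl⟩)
      · rintro _ ⟨j, rfl⟩
        exact mk_mem_stalk hxU (hX j)
    rw [this]
    exact Submodule.fg_span (Set.finite_range _)
  -- Nakayama's lemma: sections whose values form a basis of the fibre generate the stalk, once the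
  -- stalk is contained in their span plus the germs vanishing at `x` times the stalk.
  have hle : F.stalk x ≤ S := by
    refine Submodule.le_of_le_smul_of_le_jacobson_bot hfg
      (stalkRing.ker_eval_le_jacobson x) ?_
    rintro ⟨_, _⟩ ⟨W, Z, hxW, hZ, rfl⟩
    let c (i) : stalkRing n s x := stalkRing.mk ⊤ trivial (fun _ => b.repr ⟨Z x, W, Z, hxW, hZ, rfl⟩ i)
      (IsRelHol.const _ _)
    set z : tangentStalk n s x := tangentStalk.mk W hxW Z (F.isRelHolField hZ)
    change z ∈ _
    have hz : z - ∑ i, c i • y i ∈ F.stalk x :=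
      sub_mem (mk_mem_stalk hxW hZ) (Submodule.sum_mem _ fun i _ => Submodule.smul_mem _ _
        (mk_mem_stalk (hxV i) (hY i)))
    rw [← sub_add_cancel z (∑ i, c i • y i), add_comm]
    refine Submodule.add_mem_sup (Submodule.sum_mem _ fun i _ => Submodule.smul_mem _ _
      (Submodule.subset_span ⟨i, rfl⟩)) ?_
    -- The remainder vanishes at `x`. By the projection formula it is a combination of the `X j`
    -- with its own components as coefficients, and these lie in the kernel of `stalkRing.eval x`.
    have hval : ((z - ∑ i, c i • y i : tangentStalk n s x) : Germ (𝓝 x) (RelTangent n)).value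
        = 0 := by
      have h1 : ((z - ∑ i, c i • y i : tangentStalk n s x) : Germ (𝓝 x) (RelTangent n)) =
          ((fun w => Z w - ∑ i, b.repr ⟨Z x, W, Z, hxW, hZ, rfl⟩ i • Y i w : M → RelTangent n) :
            Germ (𝓝 x) (RelTangent n)) := by
        rw [AddSubgroupClass.coe_sub, AddSubmonoidClass.coe_finsetSum]
        change _ = (Z : Germ (𝓝 x) (RelTangent n)) - ((fun w => ∑ i, b.repr ⟨Z x, W, Z, hxW, hZ, rfl⟩ i • Y i w : M → RelTangent n) : Germ (𝓝 x) (RelTangent n))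
        rw [germ_sum]
        rfl
      rw [h1, Germ.value_ofFun, sub_eq_zero]
      have h2 := congrArg Subtype.val (b.sum_repr ⟨Z x, W, Z, hxW, hZ, rfl⟩)
      rw [AddSubmonoidClass.coe_finsetSum] at h2
      simp only [hYb]
      exact h2.symm
    obtain ⟨W', Z', hxW', hZ', hzZ'⟩ := hz
    have hzZ : z - ∑ i, c i • y i = tangentStalk.mk W' hxW' Z' (F.isRelHolField hZ') :=
      Subtype.ext hzZ'
    rw [hzZ, h W' hxW' Z' hZ']
    refine Submodule.sum_mem _ fun j _ => Submodule.smul_mem_smul ?_ (mk_mem_stalk hxU (hX j))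
    rw [RingHom.mem_ker]
    change components n s (chartAt (Model n s) x) Z' x j = 0
    rw [hzZ'] at hval
    have : Z' x = 0 := hval
    simp [components, this]
  have hS : F.stalk x = S := le_antisymm hle (Submodule.span_le.2 (by
    rintro _ ⟨i, rfl⟩; exact mk_mem_stalk (hxV i) (hY i)))
  rw [hS]
  have h1 := finrank_range_le_card (R := stalkRing n s x) y
  rwa [Fintype.card_fin] at h1

end SubmoduleSheaf

end Stalks

/-! ### Brackets in adapted charts -/

section Bracket

variable {n s : ℕ} {M P : Type*} [TopologicalSpace M] [ChartedSpace (Model n s) M]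
  [IsManifold (IM n s) ∞ M] [TopologicalSpace P]
  [ChartedSpace (Fin s → ℝ) P] [IsManifold (IP s) ∞ P] {π : M → P}
  {e : OpenPartialHomeomorph M (Model n s)}

theorem IsRelHolField.contDiffOn {U : Set M} {X : M → RelTangent n}
    (hX : IsRelHolField n s U X) (he : e ∈ atlas (Model n s) M) :
    ContDiffOn ℝ ∞ (fun y => components n s e X (e.symm y)) (e.target ∩ e.symm ⁻¹' U) :=
  contDiffOn_pi.2 fun i => (contDiffOn_comp_symm he (hX e he i).smooth).mono fun _ hy =>
    ⟨hy.1, hy.2, e.map_target hy.1⟩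

theorem IsRelHolField.differentiableAt {U : Set M} (hU : IsOpen U) {X : M → RelTangent n}
    (hX : IsRelHolField n s U X) (he : e ∈ atlas (Model n s) M) {y : Model n s}
    (hy : y ∈ e.target ∩ e.symm ⁻¹' U) :
    DifferentiableAt ℝ (fun y => components n s e X (e.symm y)) y :=
  ((hX.contDiffOn he).contDiffAt ((e.isOpen_inter_preimage_symm hU).mem_nhds hy)).differentiableAt
    (by simp)

theorem IsRelHolField.fderiv_smul {U : Set M} (hU : IsOpen U) {X : M → RelTangent n}
    (hX : IsRelHolField n s U X) (he : e ∈ atlas (Model n s) M) {y : Model n s}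
    (hy : y ∈ e.target ∩ e.symm ⁻¹' U) (c : ℂ) (w : Fin n → ℂ) :
    fderiv ℝ (fun y => components n s e X (e.symm y)) y (c • w, 0) =
      c • fderiv ℝ (fun y => components n s e X (e.symm y)) y (w, 0) := by
  have h := hX.differentiableAt hU he hy
  have h1 (w : Fin n → ℂ) (i : Fin n) :
      fderiv ℝ (fun y => components n s e X (e.symm y)) y (w, 0) i =
        fderiv ℝ (fun y => components n s e X (e.symm y) i) y (w, 0) := by
    rw [(hasFDerivAt_pi'.1 h.hasFDerivAt i).fderiv]
    rfl
  ext i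
  rw [Pi.smul_apply, h1, h1]
  exact (hX e he i).fderiv_smul (hU.inter e.open_source) he ⟨hy.1, hy.2, e.map_target hy.1⟩ c w

theorem IsRelHolField.fderiv_slice {U : Set M} (hU : IsOpen U) {X : M → RelTangent n}
    (hX : IsRelHolField n s U X) (he : e ∈ atlas (Model n s) M) {y : Model n s}
    (hy : y ∈ e.target ∩ e.symm ⁻¹' U) (w : Fin n → ℂ) :
    fderiv ℂ (fun z => components n s e X (e.symm (z, y.2))) y.1 w =
      fderiv ℝ (fun y => components n s e X (e.symm y)) y (w, 0) := by
  have ho := (e.isOpen_inter_preimage_symm hU).mem_nhds hy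
  have h0 : DifferentiableAt ℂ (fun z => components n s e X (e.symm (z, y.2))) y.1 := by
    refine differentiableAt_pi.2 fun i => ?_
    refine ((hX e he i).holomorphic e he y.2).differentiableAt ?_
    filter_upwards [slice_mem y ho] with z hz
    exact ⟨hz.1, hz.2, e.map_target hz.1⟩
  have h1 := (hX.differentiableAt hU he hy).hasFDerivAt.comp y.1 (hasFDerivAt_slice y)
  exact DFunLike.congr_fun ((h0.hasFDerivAt.restrictScalars ℝ).unique h1) w

/-- The bracket in an arbitrary adapted chart. -/
theorem IsDeformation.relJacobian_relBracket (hπ : IsDeformation n s π) {U : Set M}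
    (hU : IsOpen U) {X Y : M → RelTangent n} (hX : IsRelHolField n s U X)
    (hY : IsRelHolField n s U Y) (he : e ∈ atlas (Model n s) M) {x : M} (hxU : x ∈ U)
    (hx : x ∈ e.source) : relJacobian n s e x (relBracket n s X Y x) =
      fderiv ℝ (fun y => components n s e Y (e.symm y)) (e x) (components n s e X x, 0) -
      fderiv ℝ (fun y => components n s e X (e.symm y)) (e x) (components n s e Y x, 0) := by
  set c := chartAt (Model n s) x with hcdef
  have hc : c ∈ atlas (Model n s) M := chart_mem_atlas _ x
  have hxc : x ∈ c.source := mem_chart_source _ x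
  have hcx : c x ∈ c.target ∩ c.symm ⁻¹' U := ⟨c.map_source hxc, by simpa [c.left_inv hxc]⟩
  have hex : e x ∈ e.target ∩ e.symm ⁻¹' U := ⟨e.map_source hx, by simpa [e.left_inv hx]⟩
  have hov := mem_overlap (e := c) (e' := e) hxc hx
  -- Derivative of the transformation law of components. The extra term, a second derivative of the
  -- coordinate change, is symmetric and cancels in the bracket.
  have key {Z : M → RelTangent n} (hZ : IsRelHolField n s U Z) (w : Fin n → ℂ) :
      fderiv ℝ (fun y => components n s e Z (e.symm y)) (e x) (jac c e (c x) w, 0) =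
        fderiv ℝ (jac c e) (c x) (w, 0) (components n s c Z x) +
          jac c e (c x) (fderiv ℝ (fun y => components n s c Z (c.symm y)) (c x) (w, 0)) := by
    have h1 := hZ.differentiableAt hU he hex
    rw [← trans_apply (e' := e) hxc] at h1
    have h2 := h1.hasFDerivAt.comp _ (differentiableAt_trans hc he hov).hasFDerivAt
    have h3 := (differentiableAt_jac hc he hov).hasFDerivAt.clm_apply
      (hZ.differentiableAt hU hc hcx).hasFDerivAt
    have h4 : (fun y => components n s e Z (e.symm y)) ∘ trans c e =ᶠ[𝓝 (c x)]
        fun y => jac c e y (components n s c Z (c.symm y)) := by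
      filter_upwards [isOpen_overlap.mem_nhds hov] with y hy
      have h5 := hπ.jac_relJacobian hc he (c.map_target hy.1) hy.2 (Z (c.symm y))
      rw [c.right_inv hy.1] at h5
      rw [Function.comp_apply, trans, e.left_inv hy.2]
      exact h5.symm
    have h6 := DFunLike.congr_fun (h2.unique (h3.congr_of_eventuallyEq h4)) (w, 0)
    simp only [ContinuousLinearMap.comp_apply, hπ.fderiv_trans_vert hc he hov,
      add_apply, ContinuousLinearMap.flip_apply, c.left_inv hxc] at h6
    rw [trans_apply hxc] at h6
    rw [h6, add_comm]
  have hcomp (Z : M → RelTangent n) :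
      components n s e Z x = jac c e (c x) (components n s c Z x) :=
    (hπ.jac_relJacobian hc he hxc hx (Z x)).symm
  have hb : relBracket n s X Y x =
      fderiv ℝ (fun y => components n s c Y (c.symm y)) (c x) (components n s c X x, 0) -
      fderiv ℝ (fun y => components n s c X (c.symm y)) (c x) (components n s c Y x, 0) := by
    rw [← hY.fderiv_slice hU hc hcx, ← hX.fderiv_slice hU hc hcx]
    simp only [relBracket, VectorField.lieBracket_eq, ← hcdef]
    rw [show ((c x).1, (c x).2) = c x from rfl, c.left_inv hxc]
  rw [hcomp X, hcomp Y, key hX, key hY, ← hπ.jac_relJacobian hc he hxc hx, hb,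
    hπ.relJacobian_chartAt, map_sub, fderiv_jac_symm hc he hov (components n s c X x)]
  abel

end Bracket

/-! ### Local projections along the foliation -/

section Projection

variable {n s : ℕ} {M P : Type*} [TopologicalSpace M] [ChartedSpace (Model n s) M]
  {e : OpenPartialHomeomorph M (Model n s)}

/-- A family of projections `Π y` of `ℂⁿ`, smooth and holomorphic along the leaves `t = const`,
whose kernels are the fibres of `F` over `U`, in the frame of the chart `e`. -/
structure IsTransverse (F : SubmoduleSheaf n s M) (e : OpenPartialHomeomorph M (Model n s))
    (U : Set M) (p : Model n s → (Fin n → ℂ) →L[ℝ] (Fin n → ℂ)) : Prop where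
  subset : U ⊆ e.source
  smooth : ContDiffOn ℝ ∞ p (e.target ∩ e.symm ⁻¹' U)
  map_smul : ∀ y ∈ e.target ∩ e.symm ⁻¹' U, ∀ (c : ℂ) v, p y (c • v) = c • p y v
  fderiv_smul : ∀ y ∈ e.target ∩ e.symm ⁻¹' U, ∀ (c : ℂ) (w v : Fin n → ℂ),
    fderiv ℝ p y (c • w, 0) v = c • fderiv ℝ p y (w, 0) v
  idem : ∀ y ∈ e.target ∩ e.symm ⁻¹' U, ∀ v, p y (p y v) = p y v
  mem_fiber : ∀ x ∈ U, ∀ v, ofComponents e x v ∈ F.fiber x ↔ p (e x) v = 0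
  involutive : ∀ y ∈ e.target ∩ e.symm ⁻¹' U, ∀ u v, p y u = 0 → p y v = 0 →
    p y (fderiv ℝ p y (u, 0) v) = p y (fderiv ℝ p y (v, 0) u)

theorem SubmoduleSheaf.value_mem_fiber {F : SubmoduleSheaf n s M} {U : Opens M}
    {X : M → RelTangent n} (hX : F.IsSec U X) {x : M} (hx : x ∈ U) : X x ∈ F.fiber x :=
  ⟨U, X, hx, hX, rfl⟩

namespace IsTransverse

variable {F : SubmoduleSheaf n s M} {U : Set M}
  {p : Model n s → (Fin n → ℂ) →L[ℝ] (Fin n → ℂ)}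

theorem hasFDerivAt (h : IsTransverse F e U p) (hU : IsOpen U) {y : Model n s}
    (hy : y ∈ e.target ∩ e.symm ⁻¹' U) : HasFDerivAt p (fderiv ℝ p y) y :=
  ((h.smooth.contDiffAt ((e.isOpen_inter_preimage_symm hU).mem_nhds hy)).differentiableAt
    (by simp)).hasFDerivAt

theorem fderiv_idem (h : IsTransverse F e U p) (hU : IsOpen U) {y : Model n s}
    (hy : y ∈ e.target ∩ e.symm ⁻¹' U) (u : Model n s) (v : Fin n → ℂ) :
    fderiv ℝ p y u (p y v) + p y (fderiv ℝ p y u v) = fderiv ℝ p y u v := by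
  have h0 := h.hasFDerivAt hU hy
  have h1 := h0.clm_apply (hasFDerivAt_const v y)
  have h2 := h0.clm_apply h1
  have h3 : (fun y => p y (p y v)) =ᶠ[𝓝 y] fun y => p y v := by
    filter_upwards [(e.isOpen_inter_preimage_symm hU).mem_nhds hy] with z hz using h.idem z hz v
  have h4 := DFunLike.congr_fun (h2.unique (h1.congr_of_eventuallyEq h3)) u
  simpa [add_comm] using h4

/-- Apply `p` to the derivative of `p² = p`: the derivative of a projection is off-diagonal with
respect to image and kernel. -/
theorem apply_fderiv_apply (h : IsTransverse F e U p) (hU : IsOpen U) {y : Model n s}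
    (hy : y ∈ e.target ∩ e.symm ⁻¹' U) (u : Model n s) (v : Fin n → ℂ) :
    p y (fderiv ℝ p y u (p y v)) = 0 := by
  have h1 := congrArg (p y) (h.fderiv_idem hU hy u v)
  rwa [map_add, h.idem y hy, add_eq_right] at h1

theorem fderiv_map_smul (h : IsTransverse F e U p) (hU : IsOpen U) {y : Model n s}
    (hy : y ∈ e.target ∩ e.symm ⁻¹' U) (u : Model n s) (c : ℂ) (v : Fin n → ℂ) :
    fderiv ℝ p y u (c • v) = c • fderiv ℝ p y u v := by
  have h0 := h.hasFDerivAt hU hy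
  have h1 := h0.clm_apply (hasFDerivAt_const (c • v) y)
  have h2 := (h0.clm_apply (hasFDerivAt_const v y)).const_smul c
  have h3 : (fun y => p y (c • v)) =ᶠ[𝓝 y] fun y => c • p y v := by
    filter_upwards [(e.isOpen_inter_preimage_symm hU).mem_nhds hy] with z hz
      using h.map_smul z hz c v
  have h4 := DFunLike.congr_fun (h1.unique (h2.congr_of_eventuallyEq h3)) u
  simpa using h4

end IsTransverse

/-- The Christoffel symbols `Γ(u) v = (∂_u Π) v + (∂_{Π v} Π) u` of the local connection. -/
def christoffel (p : Model n s → (Fin n → ℂ) →L[ℝ] (Fin n → ℂ)) (y : Model n s) :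
    Model n s →L[ℝ] (Fin n → ℂ) →L[ℝ] (Fin n → ℂ) :=
  fderiv ℝ p y + ContinuousLinearMap.flipₗᵢ ℝ _ _ _ (fderiv ℝ p y ∘L vert n s ∘L p y) ∘L
    ContinuousLinearMap.fst ℝ _ _

theorem christoffel_apply (p : Model n s → (Fin n → ℂ) →L[ℝ] (Fin n → ℂ)) (y u : Model n s)
    (v : Fin n → ℂ) :
    christoffel p y u v = fderiv ℝ p y u v + fderiv ℝ p y (p y v, 0) u.1 := by
  simp [christoffel]

namespace IsTransverse

variable {F : SubmoduleSheaf n s M} {U : Set M}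
  {p : Model n s → (Fin n → ℂ) →L[ℝ] (Fin n → ℂ)}

theorem contDiffOn_christoffel (h : IsTransverse F e U p) (hU : IsOpen U) :
    ContDiffOn ℝ ∞ (christoffel p) (e.target ∩ e.symm ⁻¹' U) := by
  have h1 : ContDiffOn ℝ ∞ (fderiv ℝ p) (e.target ∩ e.symm ⁻¹' U) :=
    h.smooth.fderiv_of_isOpen (e.isOpen_inter_preimage_symm hU) (by simp)
  refine contDiffOn_clm_apply.2 fun u => contDiffOn_clm_apply.2 fun v => ?_
  simp only [christoffel_apply]
  exact ((h1.clm_apply contDiffOn_const).clm_apply contDiffOn_const).add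
    ((h1.clm_apply ((h.smooth.clm_apply contDiffOn_const).prodMk contDiffOn_const)).clm_apply
      contDiffOn_const)

/-- In the second term of `Γ` the vector `p y v` is a direction of differentiation; complex
linearity there is exactly the holomorphy of `p` along the slices. -/
theorem christoffel_smul (h : IsTransverse F e U p) (hU : IsOpen U) {y : Model n s}
    (hy : y ∈ e.target ∩ e.symm ⁻¹' U) (u : Model n s) (c : ℂ) (v : Fin n → ℂ) :
    christoffel p y u (c • v) = c • christoffel p y u v := by
  rw [christoffel_apply, christoffel_apply, h.fderiv_map_smul hU hy, h.map_smul y hy,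
    h.fderiv_smul y hy, smul_add]

/-- On the kernel of `p` the second term of `Γ` drops out, and `(∂_u p) v` already lies in the image
of `p`, again by differentiating `p² = p`. -/
theorem apply_christoffel (h : IsTransverse F e U p) (hU : IsOpen U) {y : Model n s}
    (hy : y ∈ e.target ∩ e.symm ⁻¹' U) (u : Model n s) {v : Fin n → ℂ} (hv : p y v = 0) :
    p y (christoffel p y u v) = fderiv ℝ p y u v := by
  have h1 := h.fderiv_idem hU hy u v
  rw [hv, map_zero, zero_add] at h1
  rw [christoffel_apply, hv, ← Prod.zero_eq_mk, map_zero, zero_apply, add_zero,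
    h1]

/-- The local connection is torsion-free modulo `F` along the fibres of `π`. -/
theorem christoffel_symm (h : IsTransverse F e U p) (hU : IsOpen U) {y : Model n s}
    (hy : y ∈ e.target ∩ e.symm ⁻¹' U) (u v : Fin n → ℂ) :
    p y (christoffel p y (u, 0) v) = p y (christoffel p y (v, 0) u) := by
  have h1 (u v) : p y (fderiv ℝ p y (u, 0) v) = p y (fderiv ℝ p y (u, 0) (v - p y v)) := by
    rw [map_sub, map_sub, h.apply_fderiv_apply hU hy, sub_zero]
  have h2 (u u' v) : fderiv ℝ p y (u - u', 0) v =
      fderiv ℝ p y (u, 0) v - fderiv ℝ p y (u', 0) v := by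
    rw [← sub_apply, ← map_sub, Prod.mk_sub_mk, sub_zero]
  -- Involutivity is applied to the components of `u` and `v` along `F`. Subtracting `p y v` from
  -- the argument changes nothing by `h1`; subtracting `p y u` from the direction produces the
  -- second terms of `Γ`.
  have h3 := h.involutive y hy (u - p y u) (v - p y v) (by rw [map_sub, h.idem y hy, sub_self])
    (by rw [map_sub, h.idem y hy, sub_self])
  rw [← h1, ← h1, h2, h2, map_sub, map_sub] at h3
  rw [christoffel_apply, christoffel_apply, map_add, map_add, ← sub_eq_zero]
  rw [← sub_eq_zero] at h3
  rw [← h3]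
  abel

/-- The class modulo `F` of `∂_u Z + Γ(u) Z` depends only on the class of `Z`. -/
theorem apply_fderiv_add_christoffel (h : IsTransverse F e U p) (hU : IsOpen U) {y : Model n s}
    (hy : y ∈ e.target ∩ e.symm ⁻¹' U) {Z : Model n s → Fin n → ℂ}
    (hZ : DifferentiableAt ℝ Z y) (hpZ : ∀ᶠ y' in 𝓝 y, p y' (Z y') = 0) (u : Model n s) :
    p y (fderiv ℝ Z y u + christoffel p y u (Z y)) = 0 := by
  -- Differentiating `p Z = 0` gives `p (∂_u Z) = -(∂_u p) Z`, which `apply_christoffel` cancels.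
  have h1 := (h.hasFDerivAt hU hy).clm_apply hZ.hasFDerivAt
  have h2 := DFunLike.congr_fun ((h1.congr_of_eventuallyEq
    (hpZ.mono fun _ h => h.symm)).unique (hasFDerivAt_const (0 : Fin n → ℂ) y)) u
  rw [map_add, h.apply_christoffel hU hy u hpZ.self_of_nhds]
  simpa using h2

end IsTransverse

variable [IsManifold (IM n s) ∞ M] [TopologicalSpace P]
  [ChartedSpace (Fin s → ℝ) P] [IsManifold (IP s) ∞ P] {π : M → P}

/-- Take `p = id - C`, where `C v` gives the components of the section `S v = ∑ v_j X_j` of `F` with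
constant coefficients. Where `v` lies in the fibre of `F`, the section `S v` has value `v`, and the
derivatives of `p` are those of `S v` up to sign; properties of sections of `F` thus become
properties of `p`. -/
theorem SubmoduleSheaf.exists_isTransverse (hπ : IsDeformation n s π) {F : SubmoduleSheaf n s M}
    (hF : F.IsDeformationOfFoliations) {x₀ : M} (hx₀ : x₀ ∉ F.singularSet) :
    ∃ (U : Opens M) (p : Model n s → (Fin n → ℂ) →L[ℝ] (Fin n → ℂ)), x₀ ∈ U ∧
      IsTransverse F (chartAt (Model n s) x₀) (U : Set M) p := by
  obtain ⟨U, hxU, hUe, X, hX, hXF⟩ := exists_fiber_projection hπ hF.coherent hx₀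
  have he := chart_mem_atlas (Model n s) x₀
  set e := chartAt (Model n s) x₀
  have hrel (v : Fin n → ℂ) : F.IsSec U (∑ j, fun x => v j • X j x) := by
    classical
    have : ∀ t : Finset (Fin n), F.IsSec U (∑ j ∈ t, fun x => v j • X j x) := fun t => by
      induction t using Finset.induction_on with
      | empty => exact F.zero U
      | insert i t hi ih =>
        rw [Finset.sum_insert hi]
        exact F.add (F.smul (IsRelHol.const _ _) (hX i)) ih
    exact this _
  let S (v : Fin n → ℂ) : M → RelTangent n := ∑ j, fun x => v j • X j x
  have hS (v : Fin n → ℂ) : IsRelHolField n s U (S v) := F.isRelHolField (hrel v)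
  let C (v : Fin n → ℂ) (y : Model n s) : Fin n → ℂ := components n s e (S v) (e.symm y)
  let p (y : Model n s) : (Fin n → ℂ) →L[ℝ] (Fin n → ℂ) :=
    ContinuousLinearMap.id ℝ _ - ∑ j, ((ContinuousLinearMap.proj (R := ℂ) (φ := fun _ => ℂ)
      j).smulRight (components n s e (X j) (e.symm y))).restrictScalars ℝ
  have hp (y) (v) : p y v = v - C v y := by
    simp [p, C, S, components]
  have hpv (v) : (fun y => p y v) = fun y => v - C v y := funext fun y => hp y v
  have ho := e.isOpen_inter_preimage_symm U.isOpen
  have hsm : ContDiffOn ℝ ∞ p (e.target ∩ e.symm ⁻¹' U) := by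
    refine contDiffOn_clm_apply.2 fun v => ?_
    rw [hpv]
    exact contDiffOn_const.sub ((hS v).contDiffOn he)
  have hd (y) (hy : y ∈ e.target ∩ e.symm ⁻¹' U) (u v) :
      fderiv ℝ p y u v = -fderiv ℝ (C v) y u := by
    have h1 := ((hsm.contDiffAt (ho.mem_nhds hy)).differentiableAt (by simp)).hasFDerivAt.clm_apply
      (hasFDerivAt_const v y)
    rw [hpv] at h1
    have h2 := ((hS v).differentiableAt U.isOpen he hy).hasFDerivAt.const_sub v
    simpa using DFunLike.congr_fun (h1.unique h2) u
  have hSF (x) (hx : x ∈ U) (v) (hv : ofComponents e x v ∈ F.fiber x) : S v x = ofComponents e x v := by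
    have h1 := hXF x hx _ hv
    rw [hπ.relJacobian_ofComponents_self he (hUe hx)] at h1
    simpa [S] using h1
  have hmem (x) (hx : x ∈ U) (v) : ofComponents e x v ∈ F.fiber x ↔ p (e x) v = 0 := by
    rw [hp, sub_eq_zero]
    constructor
    · intro h
      simp only [C, components]
      rw [e.left_inv (hUe hx), hSF x hx v h, hπ.relJacobian_ofComponents_self he (hUe hx)]
    · intro h
      rw [h]
      simp only [C, components]
      rw [e.left_inv (hUe hx), hπ.ofComponents_relJacobian he (hUe hx)]
      exact SubmoduleSheaf.value_mem_fiber (hrel v) hx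
  refine ⟨U, p, hxU, ⟨hUe, hsm, fun y hy c v => ?_, fun y hy c w v => ?_, fun y hy v => ?_, hmem,
    fun y hy u v hu hv => ?_⟩⟩
  · rw [hp, hp, smul_sub]
    congr 1
    simp [C, S, components, mul_smul, Finset.smul_sum]
  · rw [hd y hy, hd y hy, (hS v).fderiv_smul U.isOpen he hy, smul_neg]
  · obtain ⟨x, hx, rfl⟩ : ∃ x ∈ U, e x = y := ⟨e.symm y, hy.2, e.right_inv hy.1⟩
    rw [show p (e x) (p (e x) v) = p (e x) (v - C v (e x)) from congrArg _ (hp _ v), map_sub,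
      sub_eq_self, ← hmem x hx]
    simp only [C, components]
    rw [e.left_inv (hUe hx), hπ.ofComponents_relJacobian he (hUe hx)]
    exact SubmoduleSheaf.value_mem_fiber (hrel v) hx
  · obtain ⟨x, hx, rfl⟩ : ∃ x ∈ U, e x = y := ⟨e.symm y, hy.2, e.right_inv hy.1⟩
    have hcomp {w} (hw : p (e x) w = 0) : components n s e (S w) x = w := by
      rw [components, hSF x hx w ((hmem x hx w).2 hw), hπ.relJacobian_ofComponents_self he (hUe hx)]
    have h1 := hπ.relJacobian_relBracket U.isOpen (hS u) (hS v) he hx (hUe hx)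
    rw [hcomp hu, hcomp hv] at h1
    -- At `x` the components of `S u` and `S v` are `u` and `v`, so those of the bracket are `∂_u (C
    -- v) - ∂_v (C u)`. Membership in `F` says that `p` kills this difference.
    have h2 : relBracket n s (S u) (S v) x ∈ F.fiber x :=
      SubmoduleSheaf.value_mem_fiber (hF.involutive U _ _ (hrel u) (hrel v)) hx
    rw [← hπ.ofComponents_relJacobian he (hUe hx) (relBracket n s (S u) (S v) x), hmem x hx, h1,
      map_sub, sub_eq_zero] at h2
    rw [hd _ hy, hd _ hy, map_neg, map_neg]
    exact congrArg _ h2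

end Projection

/-! ### Sections of the normal bundle in adapted charts -/

section Sections

variable {n s : ℕ} {M P : Type*} [TopologicalSpace M] [ChartedSpace (Model n s) M]

/-- The class in the normal bundle of the vector with given components. -/
def SubmoduleSheaf.normalClass (F : SubmoduleSheaf n s M)
    (e : OpenPartialHomeomorph M (Model n s)) (x : M) : (Fin n → ℂ) →ₗ[ℝ] F.Normal x :=
  ((F.fiber x).mkQ.restrictScalars ℝ) ∘ₗ (ofComponents e x : (Fin n → ℂ) →ₗ[ℝ] RelTangent n)

/-- Near `x`, the section `σ` of the normal bundle is the class of the field with components `Z`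
in the chart `e`. -/
def SubmoduleSheaf.IsRep (F : SubmoduleSheaf n s M) (e : OpenPartialHomeomorph M (Model n s))
    (σ : ∀ x : M, F.Normal x) (x : M) (Z : Model n s → Fin n → ℂ) : Prop :=
  ∀ᶠ x' in 𝓝 x, σ x' = F.normalClass e x' (Z (e x'))

variable {F : SubmoduleSheaf n s M} {e c : OpenPartialHomeomorph M (Model n s)}

theorem normalClass_apply (x : M) (w : Fin n → ℂ) :
    F.normalClass e x w = (F.fiber x).mkQ (ofComponents e x w) := rfl

theorem normalClass_eq_zero {x : M} {w : Fin n → ℂ} :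
    F.normalClass e x w = 0 ↔ ofComponents e x w ∈ F.fiber x :=
  Submodule.Quotient.mk_eq_zero _

/-- The derivative of a chart. -/
def chartDeriv (e : OpenPartialHomeomorph M (Model n s)) (x : M) :
    TangentSpace (IM n s) x →L[ℝ] Model n s :=
  mfderiv (IM n s) 𝓘(ℝ, Model n s) e x

omit [ChartedSpace (Model n s) M] in
/-- Points near `x` read in a chart. -/
theorem eventually_nhds_chart {x : M} (hx : x ∈ e.source) {q : M → Prop} :
    (∀ᶠ x' in 𝓝 x, q x') ↔ ∀ᶠ y in 𝓝 (e x), q (e.symm y) := by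
  have h := e.symm.map_nhds_eq (e.map_source hx)
  rw [e.left_inv hx] at h
  rw [← h, eventually_map]

variable [IsManifold (IM n s) ∞ M] [TopologicalSpace P]
  [ChartedSpace (Fin s → ℝ) P] [IsManifold (IP s) ∞ P] {π : M → P}

theorem normalClass_smul (hπ : IsDeformation n s π) (he : e ∈ atlas (Model n s) M) {x : M}
    (hx : x ∈ e.source) (a : ℂ) (w : Fin n → ℂ) :
    F.normalClass e x (a • w) = a • F.normalClass e x w := by
  rw [normalClass_apply, normalClass_apply, hπ.ofComponents_smul he hx, map_smul]

theorem normalClass_jac (hπ : IsDeformation n s π) (he : e ∈ atlas (Model n s) M)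
    (hc : c ∈ atlas (Model n s) M) {x : M} (hx : x ∈ e.source) (hx' : x ∈ c.source)
    (w : Fin n → ℂ) : F.normalClass e x (jac c e (c x) w) = F.normalClass c x w := by
  rw [normalClass_apply, normalClass_apply, hπ.ofComponents_jac hc he hx' hx]

theorem chartDeriv_trans (he : e ∈ atlas (Model n s) M) (hc : c ∈ atlas (Model n s) M) {x : M}
    (hx : x ∈ e.source) (hx' : x ∈ c.source) (v : TangentSpace (IM n s) x) :
    chartDeriv e x v = fderiv ℝ (trans c e) (c x) (chartDeriv c x v) := by
  have h1 : MDifferentiableAt (IM n s) 𝓘(ℝ, Model n s) c x := mdifferentiableAt_atlas hc hx'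
  have h2 := (differentiableAt_trans hc he (mem_overlap hx' hx)).hasFDerivAt.hasMFDerivAt
  have h3 := h2.comp x h1.hasMFDerivAt
  have h4 : e =ᶠ[𝓝 x] trans c e ∘ c := by
    filter_upwards [c.open_source.mem_nhds hx'] with x' hx'
    exact (trans_apply hx').symm
  exact DFunLike.congr_fun (h3.congr_of_eventuallyEq h4).mfderiv v

theorem chartDeriv_chartAt (x : M) (v : TangentSpace (IM n s) x) :
    chartDeriv (chartAt (Model n s) x) x v = v := by
  have h := mfderiv_extChartAt_self (I := IM n s) (x := x)
  simp only [extChartAt_coe, modelWithCornersSelf_coe, Function.id_comp] at h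
  rw [chartDeriv, h]
  rfl

/-- A `C^∞` section of the normal bundle has `C^∞` local components. -/
theorem SubmoduleSheaf.IsSmoothSection.exists_isRep (hπ : IsDeformation n s π)
    {σ : ∀ x : M, F.Normal x} (hσ : F.IsSmoothSection σ) (he : e ∈ atlas (Model n s) M) {x : M}
    (hx : x ∈ e.source) : ∃ (W : Set (Model n s)) (Z : Model n s → Fin n → ℂ), IsOpen W ∧
      W ⊆ e.target ∧ e x ∈ W ∧ ContDiffOn ℝ ∞ Z W ∧
        ∀ y ∈ W, F.IsRep e σ (e.symm y) Z := by
  obtain ⟨U, Z, hxU, hZ, hσZ⟩ := hσ x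
  refine ⟨e.target ∩ e.symm ⁻¹' U, fun y => components n s e Z (e.symm y),
    e.isOpen_inter_preimage_symm U.isOpen, Set.inter_subset_left,
    ⟨e.map_source hx, by simpa [e.left_inv hx]⟩, ?_, fun y hy => ?_⟩
  · exact contDiffOn_pi.2 fun i => (contDiffOn_comp_symm he (hZ e he i)).mono fun y hy =>
      ⟨hy.1, hy.2, e.map_target hy.1⟩
  · filter_upwards [U.isOpen.mem_nhds hy.2, e.open_source.mem_nhds (e.map_target hy.1)] with x' h h'
    rw [hσZ x' h, normalClass_apply, e.left_inv h', components, hπ.ofComponents_relJacobian he h']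

/-- A section of the normal bundle with `C^∞` local components is `C^∞`. -/
theorem isSmoothSection_of_isRep (hπ : IsDeformation n s π) {σ : ∀ x : M, F.Normal x}
    (h : ∀ x, ∃ e ∈ atlas (Model n s) M, ∃ (W : Set (Model n s)) (Z : Model n s → Fin n → ℂ),
      x ∈ e.source ∧ IsOpen W ∧ e x ∈ W ∧ ContDiffOn ℝ ∞ Z W ∧
        ∀ x' ∈ e.source, e x' ∈ W → σ x' = F.normalClass e x' (Z (e x'))) :
    F.IsSmoothSection σ := by
  intro x
  obtain ⟨e, he, W, Z, hx, hW, hxW, hZ, hσ⟩ := h x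
  have hU : IsOpen (e.source ∩ e ⁻¹' W) := e.isOpen_inter_preimage hW
  refine ⟨⟨_, hU⟩, fun x' => ofComponents e x' (Z (e x')), ⟨hx, hxW⟩, fun e' he' i => ?_,
    fun y hy => hσ y hy.1 hy.2⟩
  refine contMDiffOn_of_comp_symm he (fun x' h => h.1.1) ?_
  have h1 : ContDiffOn ℝ ∞ (fun y => jac e e' y (Z y) i)
      (e.target ∩ e.symm ⁻¹' (e.source ∩ e ⁻¹' W ∩ e'.source)) := by
    refine contDiffOn_pi.1 (ContDiffOn.clm_apply ?_ ?_) i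
    · exact (contDiffOn_jac he he').mono fun y hy => ⟨hy.1, hy.2.2⟩
    · exact hZ.mono fun y hy => by simpa [e.right_inv hy.1] using hy.2.1.2
  refine h1.congr fun y hy => ?_
  rw [components, hπ.relJacobian_ofComponents he he' hy.2.1.1 hy.2.2, e.right_inv hy.1]

end Sections

/-! ### The local connections -/

section LocalConnection

variable {n s : ℕ} {M P : Type*} [TopologicalSpace M] [ChartedSpace (Model n s) M]

/-- The canonical local components of a section of the normal bundle. -/
def localRep (F : SubmoduleSheaf n s M) (e : OpenPartialHomeomorph M (Model n s))
    (p : Model n s → (Fin n → ℂ) →L[ℝ] (Fin n → ℂ)) (σ : ∀ x : M, F.Normal x) (y : Model n s) :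
    Fin n → ℂ :=
  p y (relJacobian n s e (e.symm y) (σ (e.symm y)).out)

/-- The local connection `∇_v Z = ∂_v Z + Γ(v) Z`. -/
def localConn (F : SubmoduleSheaf n s M) (e : OpenPartialHomeomorph M (Model n s))
    (p : Model n s → (Fin n → ℂ) →L[ℝ] (Fin n → ℂ)) (σ : ∀ x : M, F.Normal x) (x : M) :
    TangentSpace (IM n s) x →ₗ[ℝ] F.Normal x :=
  F.normalClass e x ∘ₗ ((fderiv ℝ (localRep F e p σ) (e x) +
    (christoffel p (e x)).flip (localRep F e p σ (e x)) :
      Model n s →L[ℝ] (Fin n → ℂ)) : Model n s →ₗ[ℝ] (Fin n → ℂ)) ∘ₗ (chartDeriv e x).toLinearMap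

/-- The Christoffel symbols in the chart `c` of the local connection in the chart `e`. -/
def chartChristoffel (e c : OpenPartialHomeomorph M (Model n s))
    (p : Model n s → (Fin n → ℂ) →L[ℝ] (Fin n → ℂ)) (y : Model n s) :
    Model n s →L[ℝ] (Fin n → ℂ) →L[ℝ] (Fin n → ℂ) :=
  ContinuousLinearMap.compL ℝ _ _ _ (jac e c (trans c e y)) ∘L
    (fderiv ℝ (jac c e) y + (ContinuousLinearMap.compL ℝ _ _ _).flip (jac c e y) ∘L
      christoffel p (trans c e y) ∘L fderiv ℝ (trans c e) y)

variable {F : SubmoduleSheaf n s M} {e c : OpenPartialHomeomorph M (Model n s)}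
  {p : Model n s → (Fin n → ℂ) →L[ℝ] (Fin n → ℂ)} {U : Set M}

theorem localConn_apply (σ : ∀ x : M, F.Normal x) (x : M) (v : TangentSpace (IM n s) x) :
    localConn F e p σ x v = F.normalClass e x (fderiv ℝ (localRep F e p σ) (e x) (chartDeriv e x v)
      + christoffel p (e x) (chartDeriv e x v) (localRep F e p σ (e x))) := rfl

omit [ChartedSpace (Model n s) M] in
theorem chartChristoffel_apply (y u : Model n s) (v : Fin n → ℂ) :
    chartChristoffel e c p y u v = jac e c (trans c e y) (fderiv ℝ (jac c e) y u v +
      christoffel p (trans c e y) (fderiv ℝ (trans c e) y u) (jac c e y v)) := rfl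

variable [IsManifold (IM n s) ∞ M] [TopologicalSpace P]
  [ChartedSpace (Fin s → ℝ) P] [IsManifold (IP s) ∞ P] {π : M → P}

/-- The local connection can be computed with arbitrary local components. -/
theorem IsTransverse.localConn_eq (h : IsTransverse F e U p) (hπ : IsDeformation n s π)
    (hU : IsOpen U) (he : e ∈ atlas (Model n s) M) {σ : ∀ x : M, F.Normal x} {x : M} (hx : x ∈ U)
    {Z : Model n s → Fin n → ℂ} (hσ : F.IsRep e σ x Z) (hZ : DifferentiableAt ℝ Z (e x))
    (v : TangentSpace (IM n s) x) :
    localConn F e p σ x v = F.normalClass e x (fderiv ℝ Z (e x) (chartDeriv e x v)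
      + christoffel p (e x) (chartDeriv e x v) (Z (e x))) := by
  have hxe := h.subset hx
  have hex : e x ∈ e.target ∩ e.symm ⁻¹' U := ⟨e.map_source hxe, by simpa [e.left_inv hxe]⟩
  -- Applying `p` removes the choice made by `Quotient.out`: two representatives differ by an
  -- element of the fibre of `F`, which is the kernel of `p`.
  have hrep : localRep F e p σ =ᶠ[𝓝 (e x)] fun y => p y (Z y) := by
    filter_upwards [(eventually_nhds_chart hxe).1 hσ,
      (e.isOpen_inter_preimage_symm hU).mem_nhds hex] with y hy hyU
    have h1 : (F.fiber (e.symm y)).mkQ (σ (e.symm y)).out =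
        (F.fiber (e.symm y)).mkQ (ofComponents e (e.symm y) (Z y)) := by
      rw [e.right_inv hyU.1, normalClass_apply] at hy
      rw [← hy]
      exact Quotient.out_eq _
    have hys := e.map_target hyU.1
    rw [← sub_eq_zero, ← map_sub, Submodule.mkQ_apply, Submodule.Quotient.mk_eq_zero,
      ← hπ.ofComponents_relJacobian he hys (σ (e.symm y)).out, ← map_sub,
      h.mem_fiber _ hyU.2, e.right_inv hyU.1, map_sub, sub_eq_zero] at h1
    exact h1
  have hd : DifferentiableAt ℝ (localRep F e p σ) (e x) :=
    ((h.hasFDerivAt hU hex).clm_apply hZ.hasFDerivAt).differentiableAt.congr_of_eventuallyEq hrep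
  rw [localConn_apply, ← sub_eq_zero, ← map_sub, normalClass_eq_zero, h.mem_fiber x hx]
  -- The canonical components are `p Z`, and `p Z - Z` takes values in the kernel of `p`, which the
  -- covariant derivative preserves.
  have h2 := h.apply_fderiv_add_christoffel hU hex (hd.sub hZ) (by
    filter_upwards [hrep, (e.isOpen_inter_preimage_symm hU).mem_nhds hex] with y hy hyU
    rw [Pi.sub_apply, map_sub, hy, h.idem y hyU, sub_self]) (chartDeriv e x v)
  rw [fderiv_sub hd hZ, Pi.sub_apply, map_sub, sub_apply] at h2
  rw [← h2]
  congr 1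
  abel

/-- The local connection in an arbitrary chart. -/
theorem IsTransverse.localConn_eq_chart (h : IsTransverse F e U p) (hπ : IsDeformation n s π)
    (hU : IsOpen U) (he : e ∈ atlas (Model n s) M) (hc : c ∈ atlas (Model n s) M)
    {σ : ∀ x : M, F.Normal x} {x : M} (hx : x ∈ U) (hxc : x ∈ c.source)
    {Z : Model n s → Fin n → ℂ} (hσ : F.IsRep c σ x Z) (hZ : DifferentiableAt ℝ Z (c x))
    (v : TangentSpace (IM n s) x) :
    localConn F e p σ x v = F.normalClass c x (fderiv ℝ Z (c x) (chartDeriv c x v)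
      + chartChristoffel e c p (c x) (chartDeriv c x v) (Z (c x))) := by
  have hxe := h.subset hx
  have hov := mem_overlap hxc hxe
  have hov' := mem_overlap hxe hxc
  let Z' : Model n s → Fin n → ℂ := (fun y => jac c e y (Z y)) ∘ trans e c
  have hd := (differentiableAt_jac hc he hov).hasFDerivAt.clm_apply hZ.hasFDerivAt
  have hZ' : DifferentiableAt ℝ Z' (e x) := by
    refine DifferentiableAt.comp _ ?_ (differentiableAt_trans he hc hov')
    rw [trans_apply hxe]
    exact hd.differentiableAt
  have hσ' : F.IsRep e σ x Z' := by
    filter_upwards [hσ, c.open_source.mem_nhds hxc, e.open_source.mem_nhds hxe] with x' h1 h2 h3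
    simp only [Z', Function.comp_apply]
    rw [h1, trans_apply h3, normalClass_jac hπ he hc h3 h2]
  have hZ'x : Z' (e x) = jac c e (c x) (Z (c x)) := by
    simp only [Z', Function.comp_apply]
    rw [trans_apply hxe]
  -- Chain rule for `Z'`, the field `Z` transported to the chart `e`. The derivative of `jac` is the
  -- inhomogeneous term in the transformation law of Christoffel symbols.
  have hfd (u : Model n s) : fderiv ℝ Z' (e x) (fderiv ℝ (trans c e) (c x) u) =
      fderiv ℝ (jac c e) (c x) u (Z (c x)) + jac c e (c x) (fderiv ℝ Z (c x) u) := by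
    have h1 : HasFDerivAt Z' (fderiv ℝ Z' (e x)) (trans c e (c x)) := by
      rw [trans_apply hxc]; exact hZ'.hasFDerivAt
    have h2 := h1.comp _ (differentiableAt_trans hc he hov).hasFDerivAt
    have h3 : Z' ∘ trans c e =ᶠ[𝓝 (c x)] fun y => jac c e y (Z y) := by
      filter_upwards [isOpen_overlap.mem_nhds hov] with y hy
      simp only [Z', Function.comp_apply]
      rw [trans_trans hy, trans_self hy.1]
    have h4 := DFunLike.congr_fun (h2.unique (hd.congr_of_eventuallyEq h3)) u
    simpa [add_comm] using h4
  rw [h.localConn_eq hπ hU he hx hσ' hZ', ← normalClass_jac hπ he hc hxe hxc, hZ'x,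
    chartDeriv_trans he hc hxe hxc, hfd, chartChristoffel_apply]
  congr 1
  have hJ (w : Fin n → ℂ) : jac c e (c x) (jac e c (e x) w) = w := by
    rw [← trans_apply (e' := c) hxe, hπ.jac_comp he hc he hov' ⟨hov'.1, e.map_target hov'.1⟩,
      jac_self hov'.1]
  rw [trans_apply hxc, map_add (jac c e (c x)), hJ]
  abel

theorem IsTransverse.contDiffOn_chartChristoffel (h : IsTransverse F e U p) (hU : IsOpen U)
    (he : e ∈ atlas (Model n s) M) (hc : c ∈ atlas (Model n s) M) :
    ContDiffOn ℝ ∞ (chartChristoffel e c p) (c.target ∩ c.symm ⁻¹' U) := by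
  have hsub : c.target ∩ c.symm ⁻¹' U ⊆ overlap c e := fun y hy => ⟨hy.1, h.subset hy.2⟩
  have hT := (contDiffOn_trans hc he).mono hsub
  have hT' : ContDiffOn ℝ ∞ (fderiv ℝ (trans c e)) (c.target ∩ c.symm ⁻¹' U) :=
    ((contDiffOn_trans hc he).fderiv_of_isOpen isOpen_overlap (by simp)).mono hsub
  have hJ := (contDiffOn_jac hc he).mono hsub
  have hJ' : ContDiffOn ℝ ∞ (fderiv ℝ (jac c e)) (c.target ∩ c.symm ⁻¹' U) :=
    ((contDiffOn_jac hc he).fderiv_of_isOpen isOpen_overlap (by simp)).mono hsub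
  have hG := (h.contDiffOn_christoffel hU).comp hT fun y hy =>
    ⟨(trans_mem_overlap (hsub hy)).1, by
      rw [Set.mem_preimage, trans, e.left_inv (hsub hy).2]; exact hy.2⟩
  have hK := (contDiffOn_jac he hc).comp hT fun y hy => trans_mem_overlap (hsub hy)
  refine contDiffOn_clm_apply.2 fun u => contDiffOn_clm_apply.2 fun v => ?_
  simp only [chartChristoffel_apply]
  exact hK.clm_apply (((hJ'.clm_apply contDiffOn_const).clm_apply contDiffOn_const).add
    ((hG.clm_apply (hT'.clm_apply contDiffOn_const)).clm_apply (hJ.clm_apply contDiffOn_const)))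

theorem IsTransverse.chartChristoffel_smul (h : IsTransverse F e U p) (hπ : IsDeformation n s π)
    (hU : IsOpen U) (he : e ∈ atlas (Model n s) M) (hc : c ∈ atlas (Model n s) M)
    {y : Model n s} (hy : y ∈ c.target ∩ c.symm ⁻¹' U) (u : Model n s) (a : ℂ) (v : Fin n → ℂ) :
    chartChristoffel e c p y u (a • v) = a • chartChristoffel e c p y u v := by
  have hov : y ∈ overlap c e := ⟨hy.1, h.subset hy.2⟩
  have hov' := trans_mem_overlap hov
  have hyU : trans c e y ∈ e.target ∩ e.symm ⁻¹' U :=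
    ⟨hov'.1, by rw [Set.mem_preimage, trans, e.left_inv hov.2]; exact hy.2⟩
  rw [chartChristoffel_apply, chartChristoffel_apply, hπ.fderiv_jac_smul hc he hov,
    hπ.jac_I_smul hc he hov, h.christoffel_smul hU hyU, ← smul_add, hπ.jac_I_smul he hc hov']

/-- The inhomogeneous term of the transformation law is symmetric on vertical vectors by
`fderiv_jac_symm`; the rest is symmetric modulo `F` by the computation in the chart `e`. -/
theorem IsTransverse.chartChristoffel_symm (h : IsTransverse F e U p) (hπ : IsDeformation n s π)
    (hU : IsOpen U) (he : e ∈ atlas (Model n s) M) (hc : c ∈ atlas (Model n s) M)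
    {x : M} (hx : x ∈ U) (hxc : x ∈ c.source) (u v : Fin n → ℂ) :
    F.normalClass c x (chartChristoffel e c p (c x) (u, 0) v) =
      F.normalClass c x (chartChristoffel e c p (c x) (v, 0) u) := by
  have hxe := h.subset hx
  have hov := mem_overlap hxc hxe
  have hex : e x ∈ e.target ∩ e.symm ⁻¹' U := ⟨e.map_source hxe, by simpa [e.left_inv hxe]⟩
  rw [chartChristoffel_apply, chartChristoffel_apply, fderiv_jac_symm hc he hov,
    hπ.fderiv_trans_vert hc he hov, hπ.fderiv_trans_vert hc he hov, trans_apply hxc,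
    normalClass_jac hπ hc he hxc hxe, normalClass_jac hπ hc he hxc hxe, map_add, map_add]
  congr 1
  rw [← sub_eq_zero, ← map_sub, normalClass_eq_zero, h.mem_fiber x hx, map_sub, sub_eq_zero]
  exact h.christoffel_symm hU hex _ _

end LocalConnection

/-! ### Vector fields in adapted charts -/

section VectorFields

variable {n s : ℕ} {M : Type*} [TopologicalSpace M] [ChartedSpace (Model n s) M]

/-- The expression in a chart of a vector field. -/
def chartField (e : OpenPartialHomeomorph M (Model n s)) (X : ∀ x : M, TangentSpace (IM n s) x)
    (y : Model n s) : Model n s :=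
  chartDeriv e (e.symm y) (X (e.symm y))

theorem chartField_apply {e : OpenPartialHomeomorph M (Model n s)} {x : M} (hx : x ∈ e.source)
    (X : ∀ x : M, TangentSpace (IM n s) x) : chartField e X (e x) = chartDeriv e x (X x) := by
  rw [chartField, e.left_inv hx]

variable [IsManifold (IM n s) ∞ M]

theorem trivializationAt_eq_chartDeriv {x₀ x : M} (hx : x ∈ (chartAt (Model n s) x₀).source)
    (v : TangentSpace (IM n s) x) :
    (trivializationAt (Model n s) (TangentSpace (IM n s)) x₀ ⟨x, v⟩).2 =
      chartDeriv (chartAt (Model n s) x₀) x v := by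
  have h1 := TangentBundle.continuousLinearMapAt_trivializationAt (I := IM n s) hx
  have h2 : x ∈ (trivializationAt (Model n s) (TangentSpace (IM n s)) x₀).baseSet := by simpa
  simp only [extChartAt_coe, modelWithCornersSelf_coe, Function.id_comp] at h1
  rw [chartDeriv, ← h1, Bundle.Trivialization.continuousLinearMapAt_apply,
    Bundle.Trivialization.coe_linearMapAt_of_mem _ h2]

theorem IsSmoothVectorField.contDiffOn_chartField {X : ∀ x : M, TangentSpace (IM n s) x}
    (hX : IsSmoothVectorField X) (x₀ : M) :
    ContDiffOn ℝ ∞ (chartField (chartAt (Model n s) x₀) X) (chartAt (Model n s) x₀).target := by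
  set e := chartAt (Model n s) x₀
  have h1 : ContMDiffOn (IM n s) 𝓘(ℝ, Model n s) ∞ (fun x => chartDeriv e x (X x)) e.source := by
    intro x hx
    have hx' : x ∈ (trivializationAt (Model n s) (TangentSpace (IM n s)) x₀).baseSet := by simpa
    refine (((Bundle.Trivialization.contMDiffWithinAt_section Set.univ hx').1 (hX x)).mono
      (Set.subset_univ e.source)).congr (fun x' h => ?_) ?_
    · exact (trivializationAt_eq_chartDeriv h _).symm
    · exact (trivializationAt_eq_chartDeriv hx _).symm
  exact (contDiffOn_comp_symm (chart_mem_atlas _ x₀) h1).mono fun y hy => ⟨hy, e.map_target hy⟩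

/-- The manifold bracket at `x` is computed in the preferred chart and carried back by the
derivative of that chart, which at `x` itself is the identity. -/
theorem mlieBracket_eq_lieBracket (X Y : ∀ x : M, TangentSpace (IM n s) x) (x : M) :
    VectorField.mlieBracket (IM n s) X Y x =
      VectorField.lieBracket ℝ (chartField (chartAt (Model n s) x) X)
        (chartField (chartAt (Model n s) x) Y) (chartAt (Model n s) x x) := by
  have key (X : ∀ x : M, TangentSpace (IM n s) x) :
      VectorField.mpullbackWithin 𝓘(ℝ, Model n s) (IM n s) (extChartAt (IM n s) x).symm X
        (Set.range (IM n s)) =ᶠ[𝓝 (extChartAt (IM n s) x x)]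
          chartField (chartAt (Model n s) x) X := by
    filter_upwards [extChartAt_target_mem_nhds (I := IM n s) x] with y hy
    have h1 := mfderiv_extChartAt_comp_mfderivWithin_extChartAt_symm (I := IM n s) hy
    have h2 := mfderivWithin_extChartAt_symm_comp_mfderiv_extChartAt (I := IM n s) hy
    rw [VectorField.mpullbackWithin_apply, ContinuousLinearMap.inverse_eq h2 h1]
    simp only [extChartAt_coe, extChartAt_coe_symm, modelWithCornersSelf_coe, Function.id_comp,
      modelWithCornersSelf_coe_symm, Function.comp_id]
    rfl
  have hinv (A : Model n s →L[ℝ] Model n s) (hA : A = ContinuousLinearMap.id ℝ _) (w : Model n s) :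
      A.inverse w = w := by rw [hA, ContinuousLinearMap.inverse_id]; rfl
  rw [← VectorField.mlieBracketWithin_univ, VectorField.mlieBracketWithin_apply]
  refine (hinv _ mfderiv_extChartAt_self _).trans ?_
  have hcongr (V V' W W' : Model n s → Model n s) (y : Model n s) (hV : V =ᶠ[𝓝 y] V')
      (hW : W =ᶠ[𝓝 y] W') : VectorField.lieBracketWithin ℝ V W Set.univ y =
        VectorField.lieBracket ℝ V' W' y := by
    rw [VectorField.lieBracketWithin_univ, hV.lieBracket_vectorField_eq hW]
  rw [modelWithCornersSelf_coe, Set.range_id, Set.preimage_univ, Set.univ_inter]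
  rw [modelWithCornersSelf_coe, Set.range_id] at key
  exact hcongr _ _ _ _ _ (key X) (key Y)

end VectorFields

/-! ### Gluing of the local connections -/

section Gluing

variable {n s : ℕ} {M P : Type*} [TopologicalSpace M] [ChartedSpace (Model n s) M]

/-- Local projections along `F` around each point, and a subordinate partition of unity. -/
structure TransverseCover (F : SubmoduleSheaf n s M) where
  U : M → Opens M
  proj : M → Model n s → (Fin n → ℂ) →L[ℝ] (Fin n → ℂ)
  isTransverse : ∀ a, IsTransverse F (chartAt (Model n s) a) (U a : Set M) (proj a)
  ρ : SmoothPartitionOfUnity M (IM n s) M Set.univ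
  subordinate : ρ.IsSubordinate fun a => (U a : Set M)

namespace TransverseCover

variable {F : SubmoduleSheaf n s M} (T : TransverseCover F)

/-- The connection obtained by gluing the local connections. -/
def conn (σ : ∀ x : M, F.Normal x) (x : M) : TangentSpace (IM n s) x →ₗ[ℝ] F.Normal x :=
  ∑ᶠ a, T.ρ a x • localConn F (chartAt (Model n s) a) (T.proj a) σ x

/-- The Christoffel symbols of the glued connection in the chart `c`. -/
def christoffel (c : OpenPartialHomeomorph M (Model n s)) (y : Model n s) :
    Model n s →L[ℝ] (Fin n → ℂ) →L[ℝ] (Fin n → ℂ) :=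
  ∑ᶠ a, T.ρ a (c.symm y) • chartChristoffel (chartAt (Model n s) a) c (T.proj a) y

/-- The indices of the functions which do not vanish at a point. -/
def indices (x : M) : Finset M := (T.ρ.locallyFinite.point_finite x).toFinset

theorem mem_indices {x a : M} : a ∈ T.indices x ↔ T.ρ a x ≠ 0 := by
  simp [indices]

theorem mem_of_mem_indices {x a : M} (h : a ∈ T.indices x) : x ∈ T.U a :=
  T.subordinate a (subset_tsupport _ (T.mem_indices.1 h))

theorem sum_indices (x : M) : ∑ a ∈ T.indices x, T.ρ a x = 1 := by
  rw [← finsum_eq_sum_of_support_subset]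
  · exact T.ρ.sum_eq_one (Set.mem_univ x)
  · intro a ha
    exact T.mem_indices.2 ha

theorem conn_apply (σ : ∀ x : M, F.Normal x) (x : M) (v : TangentSpace (IM n s) x) :
    T.conn σ x v =
      ∑ a ∈ T.indices x, T.ρ a x • localConn F (chartAt (Model n s) a) (T.proj a) σ x v := by
  rw [conn, finsum_eq_sum_of_support_subset (s := T.indices x), LinearMap.sum_apply]
  · rfl
  · intro a ha
    exact T.mem_indices.2 (left_ne_zero_of_smul ha)

variable {c : OpenPartialHomeomorph M (Model n s)}

theorem christoffel_apply {x : M} (hx : x ∈ c.source) (u : Model n s) (v : Fin n → ℂ) :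
    T.christoffel c (c x) u v = ∑ a ∈ T.indices x,
      T.ρ a x • chartChristoffel (chartAt (Model n s) a) c (T.proj a) (c x) u v := by
  rw [christoffel, finsum_eq_sum_of_support_subset (s := T.indices x), c.left_inv hx]
  · simp
  · intro a ha
    refine T.mem_indices.2 fun h0 => ha ?_
    change T.ρ a (c.symm (c x)) • _ = 0
    rw [c.left_inv hx, h0]
    refine ContinuousLinearMap.ext fun u => ContinuousLinearMap.ext fun v => ?_
    exact zero_smul ℝ (chartChristoffel (chartAt (Model n s) a) c (T.proj a) (c x) u v)

variable [IsManifold (IM n s) ∞ M] [TopologicalSpace P]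
  [ChartedSpace (Fin s → ℝ) P] [IsManifold (IP s) ∞ P] {π : M → P}

/-- The glued connection in local components. -/
theorem conn_eq (hπ : IsDeformation n s π) (hc : c ∈ atlas (Model n s) M)
    {σ : ∀ x : M, F.Normal x} {x : M} (hx : x ∈ c.source) {Z : Model n s → Fin n → ℂ}
    (hσ : F.IsRep c σ x Z) (hZ : DifferentiableAt ℝ Z (c x)) (v : TangentSpace (IM n s) x) :
    T.conn σ x v = F.normalClass c x (fderiv ℝ Z (c x) (chartDeriv c x v) +
      T.christoffel c (c x) (chartDeriv c x v) (Z (c x))) := by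
  rw [conn_apply, christoffel_apply T hx]
  -- The weights sum to one, so the derivative term, common to all the local connections, can be
  -- distributed over them.
  conv_rhs => rw [← one_smul ℝ (fderiv ℝ Z (c x) (chartDeriv c x v)), ← T.sum_indices x,
    Finset.sum_smul, ← Finset.sum_add_distrib, map_sum]
  refine Finset.sum_congr rfl fun a ha => ?_
  rw [(T.isTransverse a).localConn_eq_chart hπ (T.U a).isOpen (chart_mem_atlas _ a) hc
    (T.mem_of_mem_indices ha) hx hσ hZ, ← smul_add, map_smul]

theorem contDiffOn_christoffel (hc : c ∈ atlas (Model n s) M) :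
    ContDiffOn ℝ ∞ (T.christoffel c) c.target := by
  have h : ContMDiffOn (IM n s)
      𝓘(ℝ, Model n s →L[ℝ] (Fin n → ℂ) →L[ℝ] (Fin n → ℂ)) ∞
      (fun x => ∑ᶠ a, T.ρ a x • chartChristoffel (chartAt (Model n s) a) c (T.proj a) (c x))
      c.source := by
    intro x hx
    refine (T.ρ.contMDiffAt_finsum fun a ha => ?_).contMDiffWithinAt
    have hxU : x ∈ c.source ∩ (T.U a : Set M) := ⟨hx, T.subordinate a ha⟩
    have ho : IsOpen (c.source ∩ (T.U a : Set M)) := c.open_source.inter (T.U a).isOpen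
    refine ContMDiffOn.contMDiffAt ?_ (ho.mem_nhds hxU)
    refine contMDiffOn_of_comp_symm hc Set.inter_subset_left ?_
    refine (((T.isTransverse a).contDiffOn_chartChristoffel (T.U a).isOpen (chart_mem_atlas _ a)
      hc).mono fun y hy => ⟨hy.1, hy.2.2⟩).congr fun y hy => ?_
    rw [c.right_inv hy.1]
  refine ((contDiffOn_comp_symm hc h).mono fun y hy => ⟨hy, c.map_target hy⟩).congr fun y hy => ?_
  rw [c.right_inv hy]
  rfl

theorem christoffel_smul (hπ : IsDeformation n s π) (hc : c ∈ atlas (Model n s) M) {y : Model n s}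
    (hy : y ∈ c.target) (u : Model n s) (b : ℂ) (v : Fin n → ℂ) :
    T.christoffel c y u (b • v) = b • T.christoffel c y u v := by
  have hx := c.map_target hy
  rw [← c.right_inv hy, T.christoffel_apply hx, T.christoffel_apply hx, Finset.smul_sum]
  refine Finset.sum_congr rfl fun a ha => ?_
  rw [(T.isTransverse a).chartChristoffel_smul hπ (T.U a).isOpen (chart_mem_atlas _ a) hc,
    smul_comm]
  rw [c.right_inv hy]
  exact ⟨hy, T.mem_of_mem_indices ha⟩

/-- The glued connection is torsion-free along the fibres of `π`. -/
theorem christoffel_symm (hπ : IsDeformation n s π) (hc : c ∈ atlas (Model n s) M) {x : M}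
    (hx : x ∈ c.source) (u v : Fin n → ℂ) :
    F.normalClass c x (T.christoffel c (c x) (u, 0) v) =
      F.normalClass c x (T.christoffel c (c x) (v, 0) u) := by
  rw [T.christoffel_apply hx, T.christoffel_apply hx, map_sum, map_sum]
  refine Finset.sum_congr rfl fun a ha => ?_
  rw [map_smul, map_smul, (T.isTransverse a).chartChristoffel_symm hπ (T.U a).isOpen
    (chart_mem_atlas _ a) hc (T.mem_of_mem_indices ha) hx]

theorem _root_.RelFol.SubmoduleSheaf.IsSmoothSection.exists_isRep_at
    (hπ : IsDeformation n s π) {σ : ∀ x : M, F.Normal x}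
    (hσ : F.IsSmoothSection σ) (x : M) : ∃ Z : Model n s → Fin n → ℂ,
      DifferentiableAt ℝ Z (chartAt (Model n s) x x) ∧
        F.IsRep (chartAt (Model n s) x) σ x Z := by
  have hx := mem_chart_source (Model n s) x
  obtain ⟨W, Z, hW, -, hxW, hZ, hrep⟩ := hσ.exists_isRep hπ (chart_mem_atlas _ x) hx
  refine ⟨Z, (hZ.contDiffAt (hW.mem_nhds hxW)).differentiableAt (by simp), ?_⟩
  have := hrep _ hxW
  rwa [(chartAt (Model n s) x).left_inv hx] at this

/-- The glued connection. -/
def connection (hπ : IsDeformation n s π) : Connection F where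
  toFun := T.conn
  smooth σ hσ X hX := by
    refine isSmoothSection_of_isRep hπ fun x => ?_
    have hc := chart_mem_atlas (Model n s) x
    have hx := mem_chart_source (Model n s) x
    obtain ⟨W, Z, hW, hWc, hxW, hZ, hrep⟩ := hσ.exists_isRep hπ hc hx
    have hXc := (hX.contDiffOn_chartField x).mono hWc
    refine ⟨_, hc, W, fun y => fderiv ℝ Z y (chartField (chartAt (Model n s) x) X y) +
      T.christoffel (chartAt (Model n s) x) y (chartField (chartAt (Model n s) x) X y) (Z y),
      hx, hW, hxW, ?_, fun x' hx' hx'W => ?_⟩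
    · exact ((hZ.fderiv_of_isOpen hW (by simp)).clm_apply hXc).add
        ((((T.contDiffOn_christoffel hc).mono hWc).clm_apply hXc).clm_apply hZ)
    · have h1 := hrep _ hx'W
      rw [(chartAt (Model n s) x).left_inv hx'] at h1
      have h2 : DifferentiableAt ℝ Z (chartAt (Model n s) x x') :=
        (hZ.contDiffAt (hW.mem_nhds hx'W)).differentiableAt (by simp)
      rw [T.conn_eq hπ hc hx' h1 h2]
      beta_reduce
      rw [chartField_apply hx']
  add σ τ hσ hτ x v := by
    have hc := chart_mem_atlas (Model n s) x
    have hx := mem_chart_source (Model n s) x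
    obtain ⟨Z, hZ, hσZ⟩ := hσ.exists_isRep_at hπ x
    obtain ⟨Z', hZ', hτZ⟩ := hτ.exists_isRep_at hπ x
    have h : F.IsRep (chartAt (Model n s) x) (fun y => σ y + τ y) x (Z + Z') := by
      filter_upwards [hσZ, hτZ] with y h1 h2
      rw [h1, h2, Pi.add_apply, map_add]
    rw [T.conn_eq hπ hc hx h (hZ.add hZ'), T.conn_eq hπ hc hx hσZ hZ, T.conn_eq hπ hc hx hτZ hZ',
      ← map_add, fderiv_add hZ hZ', Pi.add_apply, add_apply]
    congr 1
    rw [map_add]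
    abel
  leibniz f σ hf hσ x v := by
    have hc := chart_mem_atlas (Model n s) x
    have hx := mem_chart_source (Model n s) x
    set c := chartAt (Model n s) x
    obtain ⟨Z, hZ, hσZ⟩ := hσ.exists_isRep_at hπ x
    have h : F.IsRep c (fun y => f y • σ y) x ((fun y => f (c.symm y)) • Z) := by
      filter_upwards [hσZ, c.open_source.mem_nhds hx] with y h1 h2
      rw [h1, Pi.smul_apply', normalClass_smul hπ hc h2, c.left_inv h2]
    have hfd : DifferentiableAt ℝ (fun y => f (c.symm y)) (c x) :=
      ((contDiffOn_comp_symm hc hf.contMDiffOn).contDiffAt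
        ((c.isOpen_inter_preimage_symm isOpen_univ).mem_nhds
          ⟨c.map_source hx, trivial⟩)).differentiableAt (by simp)
    have hdf : (show ℂ from mfderiv (IM n s) 𝓘(ℝ, ℂ) f x v) =
        fderiv ℝ (fun y => f (c.symm y)) (c x) (chartDeriv c x v) := by
      have h1 : MDifferentiableAt (IM n s) 𝓘(ℝ, Model n s) c x := mdifferentiableAt_atlas hc hx
      have h2 := hfd.hasFDerivAt.hasMFDerivAt.comp x h1.hasMFDerivAt
      have h3 : f =ᶠ[𝓝 x] (fun y => f (c.symm y)) ∘ c := by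
        filter_upwards [c.open_source.mem_nhds hx] with x' hx'
        simp [c.left_inv hx']
      exact DFunLike.congr_fun (h2.congr_of_eventuallyEq h3).mfderiv v
    rw [hdf, T.conn_eq hπ hc hx h (hfd.smul hZ), T.conn_eq hπ hc hx hσZ hZ, hσZ.self_of_nhds,
      ← normalClass_smul hπ hc hx, ← normalClass_smul hπ hc hx, ← map_add, Pi.smul_apply',
      c.left_inv hx, T.christoffel_smul hπ hc (c.map_source hx),
      (hfd.hasFDerivAt.smul hZ.hasFDerivAt).fderiv, smul_add]
    congr 1
    simp only [add_apply, smul_apply, ContinuousLinearMap.smulRight_apply,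
      c.left_inv hx]
    abel

end TransverseCover

end Gluing

/-! ### Curvature of a connection on a trivial bundle -/

section Curvature

variable {V E : Type*} [NormedAddCommGroup V] [NormedSpace ℝ V] [NormedAddCommGroup E]
  [NormedSpace ℝ E]

/-- The covariant derivative `∇_Y Z = ∂_Y Z + Γ(Y) Z`. -/
def covDeriv (Γ : V → V →L[ℝ] E →L[ℝ] E) (Y : V → V) (Z : V → E) (y : V) : E :=
  fderiv ℝ Z y (Y y) + Γ y (Y y) (Z y)

/-- The curvature of the connection with Christoffel symbols `Γ`. -/
def curv (Γ : V → V →L[ℝ] E →L[ℝ] E) (y u v : V) : E →L[ℝ] E :=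
  fderiv ℝ Γ y u v - fderiv ℝ Γ y v u + (Γ y u ∘L Γ y v - Γ y v ∘L Γ y u)

variable {Γ : V → V →L[ℝ] E →L[ℝ] E} {X Y : V → V} {Z : V → E} {y : V}

theorem curv_apply (u v : V) (w : E) : curv Γ y u v w =
    fderiv ℝ Γ y u v w - fderiv ℝ Γ y v u w + (Γ y u (Γ y v w) - Γ y v (Γ y u w)) := rfl

theorem hasFDerivAt_fderiv (hZ : ContDiffAt ℝ 2 Z y) :
    HasFDerivAt (fderiv ℝ Z) (fderiv ℝ (fderiv ℝ Z) y) y :=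
  ((hZ.fderiv_right (m := 1) (by norm_num)).differentiableAt (by simp)).hasFDerivAt

theorem hasFDerivAt_covDeriv (hΓ : DifferentiableAt ℝ Γ y) (hY : DifferentiableAt ℝ Y y)
    (hZ : ContDiffAt ℝ 2 Z y) :
    HasFDerivAt (covDeriv Γ Y Z) (((fderiv ℝ Z y) ∘L (fderiv ℝ Y y) +
      (fderiv ℝ (fderiv ℝ Z) y).flip (Y y)) + ((Γ y (Y y)) ∘L fderiv ℝ Z y +
        (Γ y ∘L fderiv ℝ Y y + (fderiv ℝ Γ y).flip (Y y)).flip (Z y))) y :=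
  ((hasFDerivAt_fderiv hZ).clm_apply hY.hasFDerivAt).add
    ((hΓ.hasFDerivAt.clm_apply hY.hasFDerivAt).clm_apply
      (hZ.differentiableAt (by simp)).hasFDerivAt)

/-- The second derivatives of `Z` cancel by symmetry, and the terms containing derivatives of `X`
and `Y` are those of the covariant derivative along the bracket. -/
theorem covDeriv_commutator (hΓ : DifferentiableAt ℝ Γ y) (hX : DifferentiableAt ℝ X y)
    (hY : DifferentiableAt ℝ Y y) (hZ : ContDiffAt ℝ 2 Z y) :
    covDeriv Γ X (covDeriv Γ Y Z) y - covDeriv Γ Y (covDeriv Γ X Z) y -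
      covDeriv Γ (VectorField.lieBracket ℝ X Y) Z y = curv Γ y (X y) (Y y) (Z y) := by
  have hs : fderiv ℝ (fderiv ℝ Z) y (X y) (Y y) = fderiv ℝ (fderiv ℝ Z) y (Y y) (X y) :=
    (hZ.isSymmSndFDerivAt (by simp)).eq _ _
  rw [covDeriv.eq_def Γ X (covDeriv Γ Y Z), (hasFDerivAt_covDeriv hΓ hY hZ).fderiv,
    covDeriv.eq_def Γ Y (covDeriv Γ X Z), (hasFDerivAt_covDeriv hΓ hX hZ).fderiv, curv_apply]
  simp only [covDeriv, VectorField.lieBracket_eq, add_apply, sub_apply, map_add, map_sub,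
    ContinuousLinearMap.comp_apply, ContinuousLinearMap.flip_apply, hs]
  abel

end Curvature

/-! ### Curvature of the glued connection and the first Bianchi identity -/

section NormalBundle

variable {n s : ℕ} {M P : Type*} [TopologicalSpace M] [ChartedSpace (Model n s) M]
  {F : SubmoduleSheaf n s M} {c : OpenPartialHomeomorph M (Model n s)}

theorem isRep_zero_mem {x : M} {Z : Model n s → Fin n → ℂ} (h : F.IsRep c (fun _ => 0) x Z) :
    F.normalClass c x (Z (c x)) = 0 := h.self_of_nhds.symm

variable [IsManifold (IM n s) ∞ M] [TopologicalSpace P]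
  [ChartedSpace (Fin s → ℝ) P] [IsManifold (IP s) ∞ P] {π : M → P}

theorem chartDeriv_surjective (hc : c ∈ atlas (Model n s) M) {x : M} (hx : x ∈ c.source) :
    Function.Surjective (chartDeriv c x) :=
  (mdifferentiable_of_mem_atlas hc).mfderiv_surjective hx

namespace TransverseCover

variable (T : TransverseCover F)

theorem differentiableAt_christoffel (hc : c ∈ atlas (Model n s) M) {y : Model n s}
    (hy : y ∈ c.target) : DifferentiableAt ℝ (T.christoffel c) y :=
  ((T.contDiffOn_christoffel hc).contDiffAt (c.open_target.mem_nhds hy)).differentiableAt (by simp)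

/-- The covariant derivatives of a section of `F` belong to `F`. -/
theorem isRep_zero_covDeriv (hπ : IsDeformation n s π) (hc : c ∈ atlas (Model n s) M) {x : M}
    (hx : x ∈ c.source) {Z : Model n s → Fin n → ℂ} (hZ : ContDiffAt ℝ 2 Z (c x))
    (h : F.IsRep c (fun _ => 0) x Z) (Y : Model n s → Model n s) :
    F.IsRep c (fun _ => 0) x (covDeriv (T.christoffel c) Y Z) := by
  have h1 : ∀ᶠ x' in 𝓝 x, DifferentiableAt ℝ Z (c x') :=
    (c.continuousAt hx).eventually ((hZ.eventually (by simp)).mono fun y hy =>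
      hy.differentiableAt (by simp))
  filter_upwards [h.eventually_nhds, h1, c.open_source.mem_nhds hx] with x' h2 h3 h4
  obtain ⟨v, hv⟩ := chartDeriv_surjective hc h4 (Y (c x'))
  have h5 : F.IsRep c (fun _ => 0) x' (fun _ => 0) := Eventually.of_forall fun _ => by simp
  -- `Z` and the zero field both represent the zero section, so they give the same value of the
  -- connection.
  have h6 := T.conn_eq hπ hc h4 h2 h3 v
  rw [T.conn_eq hπ hc h4 h5 (differentiableAt_const _)] at h6
  simpa [hv, covDeriv] using h6

/-- The curvature preserves the fibres of `F`. -/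
theorem curv_mem (hπ : IsDeformation n s π) (hc : c ∈ atlas (Model n s) M) {x : M}
    (hx : x ∈ c.source) (u v : Model n s) {w : RelTangent n} (hw : w ∈ F.fiber x) :
    F.normalClass c x (curv (T.christoffel c) (c x) u v (relJacobian n s c x w)) = 0 := by
  obtain ⟨U, X, hxU, hX, rfl⟩ := hw
  have hcx : c x ∈ c.target ∩ c.symm ⁻¹' U := ⟨c.map_source hx, by simpa [c.left_inv hx]⟩
  have hZ : ContDiffAt ℝ ∞ (fun y => components n s c X (c.symm y)) (c x) :=
    ((F.isRelHolField hX).contDiffOn hc).contDiffAt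
      ((c.isOpen_inter_preimage_symm U.isOpen).mem_nhds hcx)
  have h0 : F.IsRep c (fun _ => 0) x (fun y => components n s c X (c.symm y)) := by
    filter_upwards [U.isOpen.mem_nhds hxU, c.open_source.mem_nhds hx] with x' h1 h2
    rw [eq_comm, normalClass_eq_zero, c.left_inv h2, components,
      hπ.ofComponents_relJacobian hc h2]
    exact SubmoduleSheaf.value_mem_fiber hX h1
  have hΓ := (T.contDiffOn_christoffel hc).contDiffAt (c.open_target.mem_nhds (c.map_source hx))
  have h2 (u : Model n s) : ContDiffAt ℝ 2 (covDeriv (T.christoffel c) (fun _ => u)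
      fun y => components n s c X (c.symm y)) (c x) :=
    (((hZ.fderiv_right (m := ∞) (by simp)).clm_apply contDiffAt_const).add
      ((hΓ.clm_apply contDiffAt_const).clm_apply hZ)).of_le two_le_infty
  have h3 (u v : Model n s) := isRep_zero_mem (T.isRep_zero_covDeriv hπ hc hx (h2 u)
    (T.isRep_zero_covDeriv hπ hc hx (hZ.of_le two_le_infty) h0 fun _ => u) fun _ => v)
  -- For constant fields the bracket vanishes, so the curvature applied to a section of `F` is a
  -- difference of iterated covariant derivatives, both lying in `F` by `h3`.
  have h4 := covDeriv_commutator (X := fun _ => u) (Y := fun _ => v)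
    (T.differentiableAt_christoffel hc (c.map_source hx)) (differentiableAt_const u)
    (differentiableAt_const v) (hZ.of_le two_le_infty)
  have h5 : VectorField.lieBracket ℝ (fun _ : Model n s => u) (fun _ => v) = fun _ => 0 := by
    ext y <;> simp [VectorField.lieBracket_eq]
  have h6 := congrArg (F.normalClass c x) h4
  rw [map_sub, map_sub, h3, h3, h5] at h6
  rw [c.left_inv hx] at h6
  simpa [covDeriv, components] using h6.symm

theorem curv_smul (hπ : IsDeformation n s π) (hc : c ∈ atlas (Model n s) M) {y : Model n s}
    (hy : y ∈ c.target) (u v : Model n s) (b : ℂ) (w : Fin n → ℂ) :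
    curv (T.christoffel c) y u v (b • w) = b • curv (T.christoffel c) y u v w := by
  have hd (u v : Model n s) : fderiv ℝ (T.christoffel c) y u v (b • w) =
      b • fderiv ℝ (T.christoffel c) y u v w := by
    have h0 := (T.differentiableAt_christoffel hc hy).hasFDerivAt.clm_apply (hasFDerivAt_const v y)
    have h1 := h0.clm_apply (hasFDerivAt_const (b • w) y)
    have h2 := (h0.clm_apply (hasFDerivAt_const w y)).const_smul b
    have h3 : (fun y => T.christoffel c y v (b • w)) =ᶠ[𝓝 y]
        fun y => b • T.christoffel c y v w := by
      filter_upwards [c.open_target.mem_nhds hy] with z hz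
        using T.christoffel_smul hπ hc hz v b w
    have h4 := DFunLike.congr_fun (h1.unique (h2.congr_of_eventuallyEq h3)) u
    simpa using h4
  simp only [curv_apply, hd, T.christoffel_smul hπ hc hy, smul_add, smul_sub]

/-- The first Bianchi identity. -/
theorem curv_bianchi (hπ : IsDeformation n s π) (hc : c ∈ atlas (Model n s) M) {x : M}
    (hx : x ∈ c.source) (u v w : Fin n → ℂ) :
    F.normalClass c x (curv (T.christoffel c) (c x) (u, 0) (v, 0) w +
      curv (T.christoffel c) (c x) (v, 0) (w, 0) u +
      curv (T.christoffel c) (c x) (w, 0) (u, 0) v) = 0 := by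
  have hcx := c.map_source hx
  have hΓ := (T.contDiffOn_christoffel hc).contDiffAt (c.open_target.mem_nhds hcx)
  have key (u v w : Fin n → ℂ) : F.normalClass c x
      (fderiv ℝ (T.christoffel c) (c x) (w, 0) (u, 0) v -
        fderiv ℝ (T.christoffel c) (c x) (w, 0) (v, 0) u +
        T.christoffel c (c x) (w, 0) (T.christoffel c (c x) (u, 0) v -
          T.christoffel c (c x) (v, 0) u)) = 0 := by
    -- The torsion `Γ(u)v - Γ(v)u` of constant vertical fields lies in `F` on the whole chart, so
    -- its covariant derivative along `w` does too.
    have h0 : F.IsRep c (fun _ => 0) x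
        (fun y => T.christoffel c y (u, 0) v - T.christoffel c y (v, 0) u) := by
      filter_upwards [c.open_source.mem_nhds hx] with x' h
      rw [map_sub, T.christoffel_symm hπ hc h, sub_self]
    have h1 (u : Model n s) (v : Fin n → ℂ) := (hΓ.clm_apply (contDiffAt_const (c := u))).clm_apply
      (contDiffAt_const (c := v))
    have h2 := isRep_zero_mem (T.isRep_zero_covDeriv hπ hc hx
      (((h1 (u, 0) v).sub (h1 (v, 0) u)).of_le two_le_infty) h0 fun _ => (w, 0))
    have h3 := (T.differentiableAt_christoffel hc hcx).hasFDerivAt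
    have h4 (u : Model n s) (v : Fin n → ℂ) :=
      (h3.clm_apply (hasFDerivAt_const u (c x))).clm_apply (hasFDerivAt_const v (c x))
    rw [covDeriv, ((h4 (u, 0) v).fun_sub (h4 (v, 0) u)).fderiv] at h2
    simpa using h2
  -- In the cyclic sum of the differentiated torsion identities, the terms regroup into the three
  -- curvatures.
  have h := congrArg₂ (· + ·) (congrArg₂ (· + ·) (key u v w) (key v w u)) (key w u v)
  simp only [add_zero, ← map_add] at h
  rw [← h]
  congr 1
  simp only [curv_apply, map_sub]
  abel

/-- The curvature as an endomorphism of the fibre of the normal bundle. -/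
def curvEnd (hπ : IsDeformation n s π) (x : M) (u v : Model n s) : Module.End ℂ (F.Normal x) :=
  (F.fiber x).mapQ (F.fiber x)
    { toFun := curv (T.christoffel (chartAt (Model n s) x)) (chartAt (Model n s) x x) u v
      map_add' := map_add _
      map_smul' := T.curv_smul hπ (chart_mem_atlas _ x) (mem_chart_target _ x) u v }
    fun w hw => by
      have h := T.curv_mem hπ (chart_mem_atlas _ x) (mem_chart_source _ x) u v hw
      rwa [hπ.relJacobian_chartAt, normalClass_eq_zero, IsDeformation.ofComponents_chartAt] at h

theorem curvEnd_mkQ (hπ : IsDeformation n s π) (x : M) (u v : Model n s) (w : RelTangent n) :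
    T.curvEnd hπ x u v ((F.fiber x).mkQ w) = (F.fiber x).mkQ
      (curv (T.christoffel (chartAt (Model n s) x)) (chartAt (Model n s) x x) u v w) := rfl

/-- The curvature of the glued connection. -/
def curvature (hπ : IsDeformation n s π) : EndForm F := fun x =>
  (LinearMap.mk₂ ℝ (T.curvEnd hπ x)
    (fun u u' v => (F.fiber x).linearMap_qext (LinearMap.ext fun w => by
      simp only [LinearMap.comp_apply, LinearMap.add_apply, curvEnd_mkQ, ← map_add]
      congr 1
      simp only [curv_apply, map_add, add_apply]
      abel))
    (fun a u v => (F.fiber x).linearMap_qext (LinearMap.ext fun w => by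
      simp only [LinearMap.comp_apply, LinearMap.smul_apply, curvEnd_mkQ]
      rw [← LinearMap.map_smul_of_tower]
      congr 1
      simp only [curv_apply, map_smul, smul_apply, smul_add, smul_sub]))
    (fun u v v' => (F.fiber x).linearMap_qext (LinearMap.ext fun w => by
      simp only [LinearMap.comp_apply, LinearMap.add_apply, curvEnd_mkQ, ← map_add]
      congr 1
      simp only [curv_apply, map_add, add_apply]
      abel))
    (fun a u v => (F.fiber x).linearMap_qext (LinearMap.ext fun w => by
      simp only [LinearMap.comp_apply, LinearMap.smul_apply, curvEnd_mkQ]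
      rw [← LinearMap.map_smul_of_tower]
      congr 1
      simp only [curv_apply, map_smul, smul_apply, smul_add, smul_sub])) :
    Model n s →ₗ[ℝ] Model n s →ₗ[ℝ] Module.End ℂ (F.Normal x))

/-- The components of a covariant derivative. -/
theorem isRep_conn (hπ : IsDeformation n s π) (hc : c ∈ atlas (Model n s) M)
    {σ : ∀ x : M, F.Normal x} {x : M} (hx : x ∈ c.source) {Z : Model n s → Fin n → ℂ}
    (hσ : F.IsRep c σ x Z) (hZ : ContDiffAt ℝ 2 Z (c x)) (Y : ∀ x : M, TangentSpace (IM n s) x) :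
    F.IsRep c (fun y => T.conn σ y (Y y)) x
      (covDeriv (T.christoffel c) (chartField c Y) Z) := by
  have h1 : ∀ᶠ x' in 𝓝 x, DifferentiableAt ℝ Z (c x') :=
    (c.continuousAt hx).eventually ((hZ.eventually (by simp)).mono fun y hy =>
      hy.differentiableAt (by simp))
  filter_upwards [hσ.eventually_nhds, h1, c.open_source.mem_nhds hx] with x' h2 h3 h4
  rw [T.conn_eq hπ hc h4 h2 h3, covDeriv, chartField_apply h4]

/-- In the preferred chart at `x` all three covariant derivatives are given by `covDeriv`, and the
identity becomes `covDeriv_commutator`. -/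
theorem hasCurvature (hπ : IsDeformation n s π) :
    (T.connection hπ).HasCurvature (T.curvature hπ) := by
  intro X Y hX hY σ hσ x
  have hc := chart_mem_atlas (Model n s) x
  have hx := mem_chart_source (Model n s) x
  have hcx := mem_chart_target (Model n s) x
  obtain ⟨W, Z, hW, -, hxW, hZ, hrep⟩ := hσ.exists_isRep hπ hc hx
  have hXc : ContDiffAt ℝ ∞ (chartField (chartAt (Model n s) x) X) (chartAt (Model n s) x x) :=
    (hX.contDiffOn_chartField x).contDiffAt
      ((chartAt (Model n s) x).open_target.mem_nhds hcx)
  have hYc : ContDiffAt ℝ ∞ (chartField (chartAt (Model n s) x) Y) (chartAt (Model n s) x x) :=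
    (hY.contDiffOn_chartField x).contDiffAt
      ((chartAt (Model n s) x).open_target.mem_nhds hcx)
  have hbr := mlieBracket_eq_lieBracket X Y x
  have hdX := chartField_apply hx X
  have hdY := chartField_apply hx Y
  have hself := chartDeriv_chartAt (n := n) (s := s) x
  have hcls (w) : F.normalClass (chartAt (Model n s) x) x w = (F.fiber x).mkQ w := by
    rw [normalClass_apply, IsDeformation.ofComponents_chartAt]
  have hrep' := hrep _ hxW
  rw [(chartAt (Model n s) x).left_inv hx] at hrep'
  have hΓ := T.differentiableAt_christoffel hc hcx
  have hZ' : ContDiffAt ℝ 2 Z (chartAt (Model n s) x x) :=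
    (hZ.contDiffAt (hW.mem_nhds hxW)).of_le two_le_infty
  have hYr := T.isRep_conn hπ hc hx hrep' hZ' Y
  have hXr := T.isRep_conn hπ hc hx hrep' hZ' X
  have hX1 := hXc.differentiableAt (by simp)
  have hY1 := hYc.differentiableAt (by simp)
  have hcomm := covDeriv_commutator hΓ hX1 hY1 hZ'
  have e1 := T.conn_eq hπ hc hx hYr (hasFDerivAt_covDeriv hΓ hY1 hZ').differentiableAt (X x)
  have e2 := T.conn_eq hπ hc hx hXr (hasFDerivAt_covDeriv hΓ hX1 hZ').differentiableAt (Y x)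
  have e3 := T.conn_eq hπ hc hx hrep' (hZ'.differentiableAt (by simp))
    (VectorField.mlieBracket (IM n s) X Y x)
  change _ = T.conn (fun y => T.conn σ y (Y y)) x (X x) -
    T.conn (fun y => T.conn σ y (X y)) x (Y x) - T.conn σ x _
  rw [e1, e2, e3, ← map_sub, ← map_sub, hrep'.self_of_nhds]
  rw [← hdX, ← hdY, hself, hbr]
  refine Eq.trans ?_ (congrArg (F.normalClass (chartAt (Model n s) x) x) hcomm.symm)
  rw [hdX, hdY, hself, hself, hcls, hcls]
  rfl

end TransverseCover

end NormalBundle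

/-! ### Vanishing along the fibres -/

section Final

variable {n s : ℕ} {M P : Type*} [TopologicalSpace M] [ChartedSpace (Model n s) M]
  [IsManifold (IM n s) ∞ M] [TopologicalSpace P]
  [ChartedSpace (Fin s → ℝ) P] [IsManifold (IP s) ∞ P] {π : M → P}

/-- The vectors tangent to the fibres of `π` have no `∂/∂t`-components. -/
theorem IsDeformation.snd_eq_zero (hπ : IsDeformation n s π) {x : M}
    {v : TangentSpace (IM n s) x} (hv : mfderiv (IM n s) (IP s) π x v = 0) :
    (show Model n s from v).2 = 0 := by
  have hx := mem_chart_source (Model n s) x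
  have hc := chart_mem_atlas (Model n s) x
  obtain ⟨D, V, -, -, -, h, hh, hs, -, heq⟩ := hπ.adapted _ hc
  have hπx : π x ∈ h.source := hs ▸ ⟨x, hx, rfl⟩
  have h1 : MDifferentiableAt (IP s) 𝓘(ℝ, Fin s → ℝ) h (π x) :=
    ((contMDiffOn_of_mem_maximalAtlas hh).contMDiffAt
      (h.open_source.mem_nhds hπx)).mdifferentiableAt (by simp)
  have h2 : MDifferentiableAt (IM n s) (IP s) π x := (hπ.smooth x).mdifferentiableAt (by simp)
  have h3 := h1.hasMFDerivAt.comp x h2.hasMFDerivAt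
  have h4 : MDifferentiableAt (IM n s) 𝓘(ℝ, Model n s) (chartAt (Model n s) x) x :=
    mdifferentiableAt_atlas hc hx
  have h5 := (hasFDerivAt_snd (𝕜 := ℝ) (p := chartAt (Model n s) x x)).hasMFDerivAt.comp x
    h4.hasMFDerivAt
  have h6 : (Prod.snd ∘ chartAt (Model n s) x : M → Fin s → ℝ) =ᶠ[𝓝 x] h ∘ π := by
    filter_upwards [(chartAt (Model n s) x).open_source.mem_nhds hx] with x' hx'
      using heq x' hx'
  have h7 := DFunLike.congr_fun (hasMFDerivAt_unique h5 (h3.congr_of_eventuallyEq h6)) v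
  have h8 : (chartDeriv (chartAt (Model n s) x) x v).2 = 0 := by
    refine h7.trans ?_
    change mfderiv (IP s) 𝓘(ℝ, Fin s → ℝ) h (π x) (mfderiv (IM n s) (IP s) π x v) = 0
    rw [hv, map_zero]
  rwa [chartDeriv_chartAt] at h8

/-- With no singular points the local projections exist everywhere, and a Hausdorff second countable
manifold carries a smooth partition of unity subordinate to their domains. -/
theorem TransverseCover.nonempty [T2Space M] [SecondCountableTopology M]
    (hπ : IsDeformation n s π) {F : SubmoduleSheaf n s M} (hF : F.IsDeformationOfFoliations)
    (hS : F.singularSet = ∅) : Nonempty (TransverseCover F) := by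
  have h (x : M) := F.exists_isTransverse hπ hF (x₀ := x) (by simp [hS])
  choose U p hxU hp using h
  have : LocallyCompactSpace M := ChartedSpace.locallyCompactSpace (Model n s) M
  obtain ⟨ρ, hρ⟩ := SmoothPartitionOfUnity.exists_isSubordinate (IM n s) isClosed_univ
    (fun x => (U x : Set M)) (fun x => (U x).isOpen)
    (fun x _ => Set.mem_iUnion.2 ⟨x, hxU x⟩)
  exact ⟨⟨U, p, hp, ρ, hρ⟩⟩

/-- By Nakayama the values of `F` span at least `p` dimensions. Only this inequality is needed,
since it bounds the rank of the quotient from above. -/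
theorem SubmoduleSheaf.finrank_normal_add_le (hπ : IsDeformation n s π) {F : SubmoduleSheaf n s M}
    {p : ℕ} (hp : F.HasRank p) {x : M} (hx : x ∉ F.singularSet) :
    Module.finrank ℂ (F.Normal x) + p ≤ n := by
  have h1 := SubmoduleSheaf.finrank_stalk_le hπ hx
  have h2 : Module.finrank ℂ (F.Normal x) + Module.finrank ℂ (F.fiber x) = n :=
    (Submodule.finrank_quotient_add_finrank (F.fiber x)).trans (Module.finrank_fin_fun ℂ)
  rw [hp x hx] at h1
  omega

theorem TransverseCover.curvature_bianchi (hπ : IsDeformation n s π) {F : SubmoduleSheaf n s M}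
    (T : TransverseCover F) (x : M) {u v w : TangentSpace (IM n s) x}
    (hu : (show Model n s from u).2 = 0) (hv : (show Model n s from v).2 = 0)
    (hw : (show Model n s from w).2 = 0) :
    T.curvature hπ x u v ((F.fiber x).mkQ (show Model n s from w).1) +
      T.curvature hπ x v w ((F.fiber x).mkQ (show Model n s from u).1) +
      T.curvature hπ x w u ((F.fiber x).mkQ (show Model n s from v).1) = 0 := by
  have key (u v w : Model n s) (hu : u.2 = 0) (hv : v.2 = 0) (hw : w.2 = 0) :
      T.curvEnd hπ x u v ((F.fiber x).mkQ w.1) + T.curvEnd hπ x v w ((F.fiber x).mkQ u.1) +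
        T.curvEnd hπ x w u ((F.fiber x).mkQ v.1) = 0 := by
    have h := T.curv_bianchi hπ (chart_mem_atlas _ x) (mem_chart_source _ x) u.1 v.1 w.1
    rw [normalClass_apply, IsDeformation.ofComponents_chartAt, map_add, map_add] at h
    rw [show u = (u.1, 0) from Prod.ext rfl hu, show v = (v.1, 0) from Prod.ext rfl hv,
      show w = (w.1, 0) from Prod.ext rfl hw]
    exact h
  exact key u v w hu hv hw

end Final

end RelFol

end

theorem corollary4p3 {n s : ℕ} {M P : Type*}
    [TopologicalSpace M] [ChartedSpace (RelFol.Model n s) M] [IsManifold (RelFol.IM n s) ∞ M]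
    [T2Space M] [SecondCountableTopology M]
    [TopologicalSpace P] [ChartedSpace (Fin s → ℝ) P] [IsManifold (RelFol.IP s) ∞ P]
    [T2Space P] [SecondCountableTopology P]
    (π : M → P) (hπ : RelFol.IsDeformation n s π)
    (F : RelFol.SubmoduleSheaf n s M) (hF : F.IsDeformationOfFoliations)
    (p : ℕ) (hp : F.HasRank p) (hS : F.singularSet = ∅) :
    ∃ (D : RelFol.Connection F) (K : RelFol.EndForm F), D.HasCurvature K ∧
      ∀ (t : P) (m d : ℕ) (φ : MvPolynomial.symmetricSubalgebra (Fin m) ℂ),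
        (φ : MvPolynomial (Fin m) ℂ).IsHomogeneous d → n < d + p →
          ∀ x : M, π x = t → ∀ v : Fin (2 * d) → TangentSpace (RelFol.IM n s) x,
            (∀ i, mfderiv (RelFol.IM n s) (RelFol.IP s) π x (v i) = 0) →
              RelFol.charForm φ d (K x) v = 0 := by
  obtain ⟨T⟩ := RelFol.TransverseCover.nonempty hπ hF hS
  refine ⟨T.connection hπ, T.curvature hπ, T.hasCurvature hπ,
    fun t m d φ _ hd x _ v hv => ?_⟩
  have hrank := RelFol.SubmoduleSheaf.finrank_normal_add_le hπ hp (x := x) (by simp [hS])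
  -- The rank bound together with `n < d + p` makes the rank of `N` smaller than `d`. The vectors
  -- considered are those without `∂/∂t`-component, which include the kernel of `dπ`, and `q` sends
  -- such a vector to the class of its `z`-component.
  refine RelFol.charForm_eq_zero φ (by omega) (T.curvature hπ x)
    {u | (show RelFol.Model n s from u).2 = 0}
    (fun u => (F.fiber x).mkQ (show RelFol.Model n s from u).1) (fun ν => ?_)
    (fun u hu v hv w hw => T.curvature_bianchi hπ x hu hv hw) v fun i => hπ.snd_eq_zero (hv i)
  obtain ⟨w, rfl⟩ := (F.fiber x).mkQ_surjective ν
  exact ⟨((w, 0) : RelFol.Model n s), rfl, rfl⟩
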